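/- Let $\Bbbk$ be a field in which $2\neq 0$, let $n\ge 2$ and $1\le i\le n-1$. **The category $\mathcal C$.** Its objects are $T_0,\dots,T_n$. The space $\mathrm{Hom}(T_j,T_l)=\bigoplus_{\alpha\ge 0}\Bbbk\,a_{lj}s^\alpha$ is concentrated in degree $0$, the only nonzero $A_\infty$-operation is $$\mu^2(a_{lm}s^\beta,a_{mj}s^\alpha)=a_{lj}s^{\alpha+\beta+\delta(j,m,l)},\qquad \delta(j,m,l)=\begin{cases}0,&(j-m)(m-l)\ge 0,\\ \min(|j-m|,|m-l|),&\text{otherwise,}\end{cases}$$ and $\mathfrak q(a_{lj}s^\alpha)=2\alpha+|l-j|$ is the $\mathfrak q$-grading. The morphism $a_{jj}s^\alpha$ is also written $s^\alpha$. Let $\mathrm{Tw}^b(\mathcal C)$ be the $A_\infty$-category of bounded twisted complexes over $\mathcal C$. Its morphisms of degree $p$ are matrices $f$ of morphisms of $\mathcal C$ between components whose cohomological degrees differ by $p$; if $\delta_Y$, $\delta_Z$ are the differentials of $Y$, $Z$, then $\mu^1_\delta(f)=(-1)^{|f|}\delta_Z f-f\delta_Y$ for $f:Y\to Z$ and $\mu^2_\delta(g,f)=(-1)^{|f|}gf$,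 and the other operations vanish. **The functors.** Let $\mathrm{id}:\mathcal C\to\mathrm{Tw}^b(\mathcal C)$ be the inclusion. Let $\beta=\beta_{i}^-:\mathcal C\to\mathrm{Tw}^b(\mathcal C)$ be the $A_\infty$-functor with $\beta T_j=T_j$ for $j\ne i$ and $$\beta T_i=\bigl(T_i\xrightarrow{[\,a_{i-1,i},\,-a_{i+1,i}]}T_{i-1}\oplus T_{i+1}\bigr),$$ where $T_i$ is in degree $-1$ and $T_{i-1}\oplus T_{i+1}$ in degree $0$, and with the following components. * $\beta^1(a_{lj}s^\alpha)$ is: $a_{lj}s^\alpha$ for $j,l\neq i$; the map $a_{i+1,j}s^\alpha$ into $T_{i+1}$ for $l=i<j$; the map $a_{i-1,j}s^\alpha$ into $T_{i-1}$ for $j<i=l$; the map $[a_{l,i-1}s^\alpha,\ a_{l,i+1}s^{\alpha+1}]$ out of $T_{i-1}\oplus T_{i+1}$ for $j=i<l$; the map $[a_{l,i-1}s^{\alpha+1},\ a_{l,i+1}s^{\alpha}]$ out of $T_{i-1}\oplus T_{i+1}$ for $l<i=j$; and $s^\alpha$ on each of the three components for $j=l=i$. * $\beta^2(a_{lm}s^\beta,a_{mj}s^\alpha)$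 vanishes for $l\ne i$. For $l=i$ it takes values in the component $T_i$ of $\beta T_i$: for $j\neq i$ it is $\mathrm{sgn}(i-m)\,a_{ij}s^{\alpha+\beta+|i-m|-1}$ if $m<i<j$ or $j<i<m$, and $0$ otherwise; for $j=i$ it is $a_{i,i+1}s^{\alpha+\beta+|i-m|-1}$ on the component $T_{i+1}$ of the source $\beta T_i$ if $m<i$, it is $-a_{i,i-1}s^{\alpha+\beta+|i-m|-1}$ on the component $T_{i-1}$ if $m>i$, and $0$ if $m=i$. * $\beta^d=0$ for $d\ge 3$. **Natural transformations.** A pre-natural transformation $\eta:\mathrm{id}\Rightarrow\beta$ of degree $g$ is a family $(\eta^d)_{d\ge0}$ of multilinear maps $\eta^d:\mathrm{Hom}(X_{d-1},X_d)\otimes\cdots\otimes\mathrm{Hom}(X_0,X_1)\to\mathrm{Hom}(X_0,\beta X_d)[g-d]$. Its differential is $$(\mu^1\eta)^d(a_d,\dots,a_1)=\mu^1_\delta(\eta^d(a_d,\dots,a_1))+\sum_{p}\mu^2_\delta\bigl(\beta^{d-p}(a_d,\dots,a_{p+1}),\eta^p(a_p,\dots,a_1)\bigr)+(-1)^{g-1}\mu^2_\delta\bigl(\eta^{d-1}(a_d,\dots,a_2),a_1\bigr)-\sum_t(-1)^{t+g-1}\eta^{d-1}(a_d,\dots,\mu^2(a_{t+2},a_{t+1}),\dots,a_1).$$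 The natural transformations of degree $g$ are those with $\mu^1\eta=0$, and $\mathrm{HH}^g(\mathfrak B_{i^-})=H^g\mathrm{Hom}(\mathrm{id},\beta)$ is the cohomology of this complex. **Theorem.** For every finitely supported sequence $\sigma=\{\sigma_\ell\}_{\ell\ge0}\in\Bbbk^{\mathbb Z_{\ge0}}=\bigoplus_{\ell\ge0}\Bbbk$ there is a natural transformation $\eta_\sigma:\mathrm{id}\Rightarrow\beta_i^-$ of degree $1$, depending linearly on $\sigma$, given by $\eta^0=\eta^3=\eta^4=\cdots=0$, $$\eta^1(a_{lj}s^\alpha)=\begin{cases}\mathfrak q(a_{lj}s^\alpha)\sum_{\ell}\tfrac12\sigma_\ell\,a_{lj}s^{\alpha+\ell},& l\ne i,\\[2pt] \mathfrak q(a_{ij}s^\alpha)\sum_{\ell}\tfrac12\sigma_\ell\,a_{i+\mathrm{sgn}(j-i),j}s^{\alpha+\ell},& l=i\ne j,\\[2pt] \mathfrak q(s^\alpha)\sum_{\ell}\tfrac12\sigma_\ell\bigl[\tfrac12a_{i-1,i}s^{\alpha+\ell-1},\ \tfrac12a_{i+1,i}s^{\alpha+\ell-1}\bigr],& l=j=i,\end{cases}$$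 where the value lies in the component $T_{i+\mathrm{sgn}(j-i)}$ of $\beta T_i$ in the second case and in $T_{i-1}\oplus T_{i+1}$ in the third, and $$\eta^2(a_{lm}s^\beta,a_{mj}s^\alpha)=\begin{cases}0,&l\neq i,\\ \mathfrak Q(a_{im}s^\beta,a_{mj}s^\alpha)\sum_{\ell}\tfrac12\sigma_\ell\,a_{ij}s^{\beta+\alpha+\delta(j,m,i)+\ell-1},&l=i,\end{cases}$$ with values in the component $T_i$ of $\beta T_i$, where for $a_2=a_{im}s^\beta$, $a_1=a_{mj}s^\alpha$ and $a_2a_1=\mu^2(a_2,a_1)$ $$\mathfrak Q(a_2,a_1)=\begin{cases}\mathrm{sgn}(i-m)\,\mathfrak q(a_2a_1),& m<i<j\text{ or }j<i<m,\\ \mathrm{sgn}(j-i)\tfrac12\,\mathfrak q(a_2),&m=i,\\ \mathrm{sgn}(i-m)\tfrac12\,\mathfrak q(a_2a_1),&j=i,\\ 0,&\text{otherwise.}\end{cases}$$ (The coefficients of the undefined terms $s^{-1}$ are zero.) The classes of the $\eta_\sigma$ are all of the cohomology, each exactly once: $\sigma\mapsto[\eta_\sigma]$ is a linear isomorphism $\Bbbk^{\mathbb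 Z_{\ge0}}\cong\mathrm{HH}^1(\mathfrak B_{i^-})$. -/

import Mathlib

open Polynomial

namespace KLRW

/-!
## The category `𝒞` of the generators `T_0, …, T_n`

The objects are the elements of `Fin (n + 1)` (`n` is the number of punctures).
Every morphism space `Hom(T_i, T_j) = ⨁_α k · a_{ji} s^α` is concentrated in degree `0` and is
stored as the space of polynomials `k[s]`: the monomial `X ^ α` stands for `a_{ji} s^α`.
All `μ^d` with `d ≠ 2` vanish.
-/

/-- The distance `|i - j|` of two labels. -/
def gap {n : ℕ} (i j : Fin (n + 1)) : ℕ := ((i : ℤ) - (j : ℤ)).natAbs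

/-- The sign of `i - j`. -/
def sgn {n : ℕ} (i j : Fin (n + 1)) : ℤ := ((i : ℤ) - (j : ℤ)).sign

/-- The exponent `δ(i,j,l)`: it is `0` if `(i-j)(j-l) ≥ 0`, and `min(|i-j|, |j-l|)` otherwise. -/
def overlap {n : ℕ} (i j l : Fin (n + 1)) : ℕ :=
  if 0 ≤ ((i : ℤ) - (j : ℤ)) * ((j : ℤ) - (l : ℤ)) then 0 else min (gap i j) (gap j l)

/-- The product `μ²(b, a)` of `a ∈ Hom(T_i, T_j)` and `b ∈ Hom(T_j, T_l)`, the bilinear extension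
of `μ²(a_{lj} s^β, a_{ji} s^α) = a_{li} s^{β + α + δ(i,j,l)}`. -/
noncomputable def mul {k : Type*} [Field k] {n : ℕ} (i j l : Fin (n + 1)) (b a : k[X]) : k[X] :=
  X ^ overlap i j l * (b * a)

/-- The `𝔮`-grading `2α + |i - j|` of the morphism `a_{ji} s^α`. -/
def qdeg {n : ℕ} (j i : Fin (n + 1)) (α : ℕ) : ℕ := 2 * α + gap i j

/-!
## Bounded twisted complexes over `𝒞`

A twisted complex has finitely many components, numbered `0, …, len - 1`. A morphism is a matrix
of morphisms of `𝒞`; the entry `f r c` goes from component `c` of the source to component `r` of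
the target. Matrices are stored with rows and columns in `ℕ`, and `TwHom p Y Z` singles out
those that are supported on the components and are homogeneous of degree `p`.
-/

/-- Matrices with entries in `k[s]`. -/
abbrev Mat (k : Type*) [Field k] := ℕ → ℕ → k[X]

/-- The matrix whose only entry is `f`, in row `r` and column `c`. -/
noncomputable def entry {k : Type*} [Field k] (r c : ℕ) (f : k[X]) : Mat k :=
  fun r' c' => if r' = r ∧ c' = c then f else 0

/-- Bounded twisted complexes over `𝒞`. Since the morphisms of `𝒞` have degree `0` and only `μ²`
is nonzero, the differential has entries from cohomological degree `p` to `p + 1` only, and the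
Maurer--Cartan equation reads `δ² = 0`. (The values of `obj` and `deg` at `len` and beyond play
no role.) -/
structure Tw (k : Type*) [Field k] (n : ℕ) where
  len : ℕ
  obj : ℕ → Fin (n + 1)
  deg : ℕ → ℤ
  diff : Mat k
  diff_deg : ∀ r c, diff r c ≠ 0 → r < len ∧ c < len ∧ deg r - deg c = 1
  diff_sq : ∀ r c, ∑ m ∈ Finset.range len, mul (obj c) (obj m) (obj r) (diff r m) (diff m c) = 0

section
variable {k : Type*} [Field k] {n : ℕ}

/-- `Hom^p(Y, Z)` for twisted complexes `Y` and `Z`. -/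
def TwHom (p : ℤ) (Y Z : Tw k n) : Submodule k (Mat k) where
  carrier := {f | ∀ r c, f r c ≠ 0 → r < Z.len ∧ c < Y.len ∧ Z.deg r - Y.deg c = p}
  zero_mem' := by intro r c h; simp at h
  add_mem' := by
    intro f g hf hg r c h
    by_cases h1 : f r c = 0
    · exact hg r c (by intro h2; simp [h1, h2] at h)
    · exact hf r c h1
  smul_mem' := by
    intro a f hf r c h
    exact hf r c (by intro h2; simp [h2] at h)

/-- The composition `g · f` of `f : W → Y` and `g : Y → Z`, without any sign. -/
noncomputable def comp (W Y Z : Tw k n) (g f : Mat k) : Mat k := fun r c =>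
  ∑ m ∈ Finset.range Y.len, mul (W.obj c) (Y.obj m) (Z.obj r) (g r m) (f m c)

/-- `μ¹_δ(f) = (-1)^{|f|} δ · f - f · δ` for `f : Y → Z` of degree `p`. -/
noncomputable def mu1 (Y Z : Tw k n) (p : ℤ) (f : Mat k) : Mat k :=
  p.negOnePow • comp Y Z Z Z.diff f - comp Y Y Z f Y.diff

/-- `μ²_δ(g, f) = (-1)^{|f|} g · f` for `f : W → Y` of degree `p` and `g : Y → Z`. -/
noncomputable def mu2 (W Y Z : Tw k n) (p : ℤ) (g f : Mat k) : Mat k :=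
  p.negOnePow • comp W Y Z g f

/-!
## `A_∞`-functors from `𝒞` to `Tw^b(𝒞)` and their pre-natural transformations

A chain `T_{x 0} → T_{x 1} → ⋯ → T_{x d}` of `d` composable morphisms is given by the sequence
`x` of its objects and the sequence `a` of its morphisms, `a m : T_{x m} → T_{x (m+1)}`; so `a 0`
is the morphism that is usually written `a_1`, and `a (d-1)` is `a_d`.
-/

/-- A family of maps, one for every `d` and every sequence of `d + 1` objects. -/
abbrev Family (k : Type*) [Field k] (n : ℕ) :=
  ∀ d : ℕ, (Fin (d + 1) → Fin (n + 1)) → (Fin d → k[X]) → Mat k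

/-- The first `p` morphisms `(a_p, …, a_1)` of a chain, and the objects between them. -/
def Family.low (φ : Family k n) {d : ℕ} (p : Fin (d + 1)) (x : Fin (d + 1) → Fin (n + 1))
    (a : Fin d → k[X]) : Mat k :=
  φ p (fun m => x ⟨m, by omega⟩) (fun m => a ⟨m, by omega⟩)

/-- The last `d - p` morphisms `(a_d, …, a_{p+1})` of a chain, and the objects between them. -/
def Family.up (φ : Family k n) {d : ℕ} (p : Fin (d + 1)) (x : Fin (d + 1) → Fin (n + 1))
    (a : Fin d → k[X]) : Mat k :=
  φ (d - p) (fun m => x ⟨p + m, by omega⟩) (fun m => a ⟨p + m, by omega⟩)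

/-- The sum over `t` of the terms
`(-1)^{ε + ✠_t} φ^{d-1}(a_d, …, a_{t+3}, μ²(a_{t+2}, a_{t+1}), a_t, …, a_1)`, where
`✠_t = |a_1| + ⋯ + |a_t| - t = -t`. -/
noncomputable def Family.insertMul (φ : Family k n) (ε : ℤ) : Family k n
  | 0, _, _ => 0
  | d + 1, x, a => ∑ t : Fin d, (ε - (t : ℤ)).negOnePow •
      φ d (fun m => x (t.succ.castSucc.succAbove m)) (fun m =>
        if m < t then a m.castSucc
        else if m = t then
          mul (x t.castSucc.castSucc) (x t.succ.castSucc) (x t.succ.succ) (a t.succ) (a t.castSucc)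
        else a m.succ)

/-- The family consists of multilinear maps. -/
def Family.IsMultilinear (φ : Family k n) : Prop :=
  ∀ d x, ∃ f : MultilinearMap k (fun _ : Fin d => k[X]) (Mat k), ∀ a, φ d x a = f a

end

/-- `A_∞`-functors `F : 𝒞 → Tw^b(𝒞)`: the component `F^d = map d` has degree `1 - d`, there is no
`F^0`, and the `A_∞`-equations hold (only `μ²` is nonzero in `𝒞`, and only `μ¹`, `μ²` in
`Tw^b(𝒞)`). -/
structure AInfFunctor (k : Type*) [Field k] (n : ℕ) where
  obj : Fin (n + 1) → Tw k n
  map : Family k n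
  map_zero : ∀ x a, map 0 x a = 0
  multilinear : map.IsMultilinear
  degree : ∀ (d : ℕ) x a, map d x a ∈ TwHom (1 - d) (obj (x 0)) (obj (x (Fin.last d)))
  relation : ∀ (d : ℕ) x a,
    mu1 (obj (x 0)) (obj (x (Fin.last d))) (1 - d) (map d x a)
      + ∑ p : Fin (d + 1), mu2 (obj (x 0)) (obj (x p)) (obj (x (Fin.last d))) (1 - (p : ℕ))
          (map.up p x a) (map.low p x a)
      = map.insertMul 0 d x a

section
variable {k : Type*} [Field k] {n : ℕ}

/-- Pre-natural transformations `F ⇒ G` of degree `g`: families of multilinear maps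
`η^d : Hom(X_{d-1}, X_d) ⊗ ⋯ ⊗ Hom(X_0, X_1) → Hom(F X_0, G X_d)[g - d]`, `d ≥ 0`. -/
def PreNat (F G : AInfFunctor k n) (g : ℤ) : Submodule k (Family k n) where
  carrier := {η | η.IsMultilinear ∧
    ∀ (d : ℕ) x a, η d x a ∈ TwHom (g - d) (F.obj (x 0)) (G.obj (x (Fin.last d)))}
  zero_mem' := ⟨fun _ _ => ⟨0, fun _ => rfl⟩, fun _ _ _ => Submodule.zero_mem _⟩
  add_mem' := by
    rintro η θ ⟨h1, h2⟩ ⟨h3, h4⟩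
    refine ⟨fun d x => ?_, fun d x a => Submodule.add_mem _ (h2 d x a) (h4 d x a)⟩
    obtain ⟨f, hf⟩ := h1 d x
    obtain ⟨f', hf'⟩ := h3 d x
    exact ⟨f + f', fun a => by simp [hf, hf']⟩
  smul_mem' := by
    rintro c η ⟨h1, h2⟩
    refine ⟨fun d x => ?_, fun d x a => Submodule.smul_mem _ c (h2 d x a)⟩
    obtain ⟨f, hf⟩ := h1 d x
    exact ⟨c • f, fun a => by simp [hf]⟩

lemma mul_add' (i j l : Fin (n + 1)) (b a a' : k[X]) :
    mul i j l b (a + a') = mul i j l b a + mul i j l b a' := by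
  simp only [mul]; ring

lemma add_mul' (i j l : Fin (n + 1)) (b b' a : k[X]) :
    mul i j l (b + b') a = mul i j l b a + mul i j l b' a := by
  simp only [mul]; ring

lemma mul_smul' (i j l : Fin (n + 1)) (c : k) (b a : k[X]) :
    mul i j l b (c • a) = c • mul i j l b a := by
  simp only [mul, mul_smul_comm]

lemma smul_mul' (i j l : Fin (n + 1)) (c : k) (b a : k[X]) :
    mul i j l (c • b) a = c • mul i j l b a := by
  simp only [mul, mul_smul_comm, smul_mul_assoc]

lemma comp_add (W Y Z : Tw k n) (g f f' : Mat k) :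
    comp W Y Z g (f + f') = comp W Y Z g f + comp W Y Z g f' := by
  funext r c; simp [comp, mul_add', Finset.sum_add_distrib]

lemma add_comp (W Y Z : Tw k n) (g g' f : Mat k) :
    comp W Y Z (g + g') f = comp W Y Z g f + comp W Y Z g' f := by
  funext r c; simp [comp, add_mul', Finset.sum_add_distrib]

lemma comp_smul (W Y Z : Tw k n) (s : k) (g f : Mat k) :
    comp W Y Z g (s • f) = s • comp W Y Z g f := by
  funext r c; simp [comp, mul_smul', Finset.smul_sum]

lemma smul_comp (W Y Z : Tw k n) (s : k) (g f : Mat k) :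
    comp W Y Z (s • g) f = s • comp W Y Z g f := by
  funext r c; simp [comp, smul_mul', Finset.smul_sum]

/-- The differential `μ¹_{Fun}` on pre-natural transformations `F ⇒ G` of degree `g`:
`(μ¹ η)^d(a_d, …, a_1) = μ¹(η^d(a_d, …, a_1))
  + ∑_p μ²(G^{d-p}(a_d, …, a_{p+1}), η^p(a_p, …, a_1))
  + ∑_p (-1)^{(g-1)✠_p} μ²(η^{d-p}(a_d, …, a_{p+1}), F^p(a_p, …, a_1))
  - ∑_t (-1)^{✠_t + g - 1} η^{d-1}(a_d, …, μ²(a_{t+2}, a_{t+1}), …, a_1)`. -/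
noncomputable def natDiff (F G : AInfFunctor k n) (g : ℤ) : Family k n →ₗ[k] Family k n where
  toFun η := fun d x a =>
    mu1 (F.obj (x 0)) (G.obj (x (Fin.last d))) (g - d) (η d x a)
      + ∑ p : Fin (d + 1), mu2 (F.obj (x 0)) (G.obj (x p)) (G.obj (x (Fin.last d)))
          (g - (p : ℕ)) (G.map.up p x a) (η.low p x a)
      + ∑ p : Fin (d + 1), ((g - 1) * (-(p : ℕ))).negOnePow •
          mu2 (F.obj (x 0)) (F.obj (x p)) (G.obj (x (Fin.last d)))
            (1 - (p : ℕ)) (η.up p x a) (F.map.low p x a)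
      - η.insertMul (g - 1) d x a
  map_add' η θ := by
    have hi : (η + θ).insertMul (g - 1) = η.insertMul (g - 1) + θ.insertMul (g - 1) := by
      funext d x a
      cases d <;> simp [Family.insertMul, Finset.sum_add_distrib]
    funext d x a
    simp only [hi, Pi.add_apply, mu1, mu2, Family.up, Family.low, comp_add, add_comp, smul_add,
      Finset.sum_add_distrib]
    abel
  map_smul' s η := by
    have hi : (s • η).insertMul (g - 1) = s • η.insertMul (g - 1) := by
      funext d x a
      cases d <;> simp [Family.insertMul, Finset.smul_sum, smul_comm s]
    funext d x a
    simp only [hi, Pi.smul_apply, mu1, mu2, Family.up, Family.low, comp_smul, smul_comp,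
      smul_comm _ s, RingHom.id_apply, smul_add, smul_sub, Finset.smul_sum]

/-- `A_∞`-natural transformations `F ⇒ G` of degree `g`: the pre-natural transformations `η` of
degree `g` with `μ¹_{Fun}(η) = 0`. -/
noncomputable def NatTrans (F G : AInfFunctor k n) (g : ℤ) : Submodule k (Family k n) :=
  PreNat F G g ⊓ LinearMap.ker (natDiff F G g)

/-- The coboundaries of degree `g`, inside the natural transformations of degree `g`. -/
noncomputable def coboundaries (F G : AInfFunctor k n) (g : ℤ) : Submodule k (NatTrans F G g) :=
  ((PreNat F G (g - 1)).map (natDiff F G (g - 1))).comap (NatTrans F G g).subtype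

/-- The cohomology in degree `g` of `(Hom_{Fun}(F, G), μ¹_{Fun})`. -/
abbrev HNat (F G : AInfFunctor k n) (g : ℤ) := NatTrans F G g ⧸ coboundaries F G g


/-!
## The two functors
-/

/-- The generator `T_j`, as a twisted complex concentrated in degree `0`. -/
noncomputable def stalk (k : Type*) [Field k] {n : ℕ} (j : Fin (n + 1)) : Tw k n where
  len := 1
  obj _ := j
  deg _ := 0
  diff := 0
  diff_deg := by intro r c h; simp at h
  diff_sq := by intro r c; simp [mul]

lemma entry_apply (r c r' c' : ℕ) (f : k[X]) :
    entry r c f r' c' = if r' = r ∧ c' = c then f else 0 := rfl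

lemma mul_zero' (i j l : Fin (n + 1)) (b : k[X]) : mul i j l b 0 = 0 := by simp [mul]

lemma zero_mul' (i j l : Fin (n + 1)) (b : k[X]) : mul i j l 0 b = 0 := by simp [mul]

lemma comp_entry (W Y Z : Tw k n) (r m m' c : ℕ) (g f : k[X]) :
    comp W Y Z (entry r m g) (entry m' c f) =
      if m = m' ∧ m < Y.len then entry r c (mul (W.obj c) (Y.obj m) (Z.obj r) g f) else 0 := by
  funext r' c'
  by_cases h : m = m' ∧ m < Y.len
  · obtain ⟨rfl, h⟩ := h
    rw [if_pos ⟨rfl, h⟩, comp, Finset.sum_eq_single m]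
    · by_cases h1 : r' = r <;> by_cases h2 : c' = c <;>
        simp [h1, h2, entry_apply, mul_zero', zero_mul']
    · intro b _ hb; simp [hb, entry_apply, mul_zero']
    · intro hm; simp at hm; omega
  · rw [if_neg h]
    apply Finset.sum_eq_zero
    intro b hb
    simp at hb
    by_cases h1 : b = m
    · by_cases h2 : b = m'
      · exact absurd ⟨h1.symm.trans h2, h1 ▸ hb⟩ h
      · rw [entry_apply m', if_neg (fun hh => h2 hh.1), mul_zero']
    · rw [entry_apply r, if_neg (fun hh => h1 hh.2), zero_mul']

lemma entry_add (r c : ℕ) (f g : k[X]) : entry r c (f + g) = entry r c f + entry r c g := by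
  funext r' c'; simp only [entry_apply, Pi.add_apply]; split_ifs <;> simp

lemma entry_smul (r c : ℕ) (s : k) (f : k[X]) : entry r c (s • f) = s • entry r c f := by
  funext r' c'; simp only [entry_apply, Pi.smul_apply]; split_ifs <;> simp

lemma entry_neg (r c : ℕ) (f : k[X]) : entry r c (-f) = -entry r c f := by
  funext r' c'; simp only [entry_apply, Pi.neg_apply]; split_ifs <;> simp

lemma entry_zero (r c : ℕ) : entry r c (0 : k[X]) = 0 := by
  funext r' c'; simp [entry_apply]

lemma comp_zero (W Y Z : Tw k n) (g : Mat k) : comp W Y Z g 0 = 0 := by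
  funext r c; simp [comp, mul_zero']

lemma zero_comp (W Y Z : Tw k n) (g : Mat k) : comp W Y Z 0 g = 0 := by
  funext r c; simp [comp, zero_mul']

lemma comp_neg (W Y Z : Tw k n) (g f : Mat k) : comp W Y Z g (-f) = -comp W Y Z g f := by
  funext r c; simp [comp, mul]

lemma neg_comp (W Y Z : Tw k n) (g f : Mat k) : comp W Y Z (-g) f = -comp W Y Z g f := by
  funext r c; simp [comp, mul]

lemma entry_mem {p : ℤ} {Y Z : Tw k n} {r c : ℕ} (f : k[X]) (hr : r < Z.len) (hc : c < Y.len)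
    (h : Z.deg r - Y.deg c = p) : entry r c f ∈ TwHom p Y Z := by
  intro r' c' h'
  simp only [entry_apply] at h'
  split_ifs at h' with h1
  · obtain ⟨rfl, rfl⟩ := h1; exact ⟨hr, hc, h⟩
  · simp at h'

lemma overlap_of_left_le {i j l : Fin (n + 1)} (h1 : (i : ℕ) ≤ j) (h2 : (i : ℕ) ≤ l) :
    overlap i j l = (j : ℕ) - (l : ℕ) := by
  unfold overlap gap
  split_ifs with h
  · rcases mul_nonneg_iff.1 h with h | h <;> omega
  · rcases mul_neg_iff.1 (not_le.1 h) with h | h <;> omega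

lemma overlap_of_left_ge {i j l : Fin (n + 1)} (h1 : (j : ℕ) ≤ i) (h2 : (l : ℕ) ≤ i) :
    overlap i j l = (l : ℕ) - (j : ℕ) := by
  unfold overlap gap
  split_ifs with h
  · rcases mul_nonneg_iff.1 h with h | h <;> omega
  · rcases mul_neg_iff.1 (not_le.1 h) with h | h <;> omega

lemma overlap_of_right_le {i j l : Fin (n + 1)} (h1 : (l : ℕ) ≤ j) (h2 : (l : ℕ) ≤ i) :
    overlap i j l = (j : ℕ) - (i : ℕ) := by
  unfold overlap gap
  split_ifs with h
  · rcases mul_nonneg_iff.1 h with h | h <;> omega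
  · rcases mul_neg_iff.1 (not_le.1 h) with h | h <;> omega

lemma overlap_of_right_ge {i j l : Fin (n + 1)} (h1 : (j : ℕ) ≤ l) (h2 : (i : ℕ) ≤ l) :
    overlap i j l = (i : ℕ) - (j : ℕ) := by
  unfold overlap gap
  split_ifs with h
  · rcases mul_nonneg_iff.1 h with h | h <;> omega
  · rcases mul_neg_iff.1 (not_le.1 h) with h | h <;> omega

lemma overlap_eq (i j l : Fin (n + 1)) :
    overlap i j l = ((j : ℕ) - max (i : ℕ) l) + (min (i : ℕ) l - (j : ℕ)) := by
  unfold overlap gap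
  split_ifs with h
  · rcases mul_nonneg_iff.1 h with h | h <;> omega
  · rcases mul_neg_iff.1 (not_le.1 h) with h | h <;> omega

lemma gap_of_le {i j : Fin (n + 1)} (h : (i : ℕ) ≤ j) : gap i j = (j : ℕ) - (i : ℕ) := by
  unfold gap; omega

lemma gap_of_ge {i j : Fin (n + 1)} (h : (j : ℕ) ≤ i) : gap i j = (i : ℕ) - (j : ℕ) := by
  unfold gap; omega

lemma X_nf1 (a b : ℕ) (p : k[X]) : X ^ a * (X ^ b * p) = X ^ (a + b) * p := by ring
lemma X_nf2 (a : ℕ) (p : k[X]) : X ^ a * (X * p) = X ^ (a + 1) * p := by ring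
lemma X_nf6 (a : ℕ) (p : k[X]) : X * (X ^ a * p) = X ^ (a + 1) * p := by ring
lemma X_nf3 (a b : ℕ) (p q : k[X]) : X ^ a * (p * (X ^ b * q)) = X ^ (a + b) * (p * q) := by ring
lemma X_nf4 (a : ℕ) (p q : k[X]) : X ^ a * (p * (X * q)) = X ^ (a + 1) * (p * q) := by ring
lemma X_nf5 (a : ℕ) (p q r : k[X]) :
    X ^ a * (p * (q * (X * r))) = X ^ (a + 1) * (p * (q * r)) := by ring

/-- The twisted complex `T_i → T_{i-1} ⊕ T_{i+1}` with `T_i` in degree `-1` (component `0`),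
`T_{i-1}` and `T_{i+1}` in degree `0` (components `1` and `2`), and differential
`[a_{i-1,i}, -a_{i+1,i}]`. -/
noncomputable def braidObj (k : Type*) [Field k] {n : ℕ} (i : Fin (n + 1)) (h0 : 0 < (i : ℕ))
    (h1 : (i : ℕ) < n) : Tw k n where
  len := 3
  obj m := if m = 0 then i else if m = 1 then ⟨i - 1, by omega⟩ else ⟨i + 1, by omega⟩
  deg m := if m = 0 then -1 else 0
  diff := entry 1 0 1 + entry 2 0 (-1)
  diff_deg := by
    intro r c h
    simp only [Pi.add_apply, entry_apply] at h
    by_cases h1 : r = 1 ∧ c = 0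
    · simp [h1.1, h1.2]
    · by_cases h2 : r = 2 ∧ c = 0
      · simp [h2.1, h2.2]
      · simp [h1, h2] at h
  diff_sq := by
    intro r c
    apply Finset.sum_eq_zero
    intro m _
    by_cases hm : m = 0
    · subst hm; simp [entry_apply, mul_zero']
    · simp [entry_apply, hm, zero_mul']

/-- The first component `β¹` of the negative braiding functor: its value on the morphism
`f : T_j → T_l`. -/
noncomputable def braid1 (i j l : Fin (n + 1)) (f : k[X]) : Mat k :=
  if j = i then
    if l = i then entry 0 0 f + entry 1 1 f + entry 2 2 f
    else if i < l then entry 0 1 f + entry 0 2 (X * f)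
    else entry 0 1 (X * f) + entry 0 2 f
  else if l = i then
    if i < j then entry 2 0 f else entry 1 0 f
  else entry 0 0 f

/-- The second component `β²` of the negative braiding functor: its value on the morphisms
`f : T_j → T_m` and `g : T_m → T_l`. It is nonzero only for `l = i`, and takes values in the
degree `-1` component `T_i` of `T_i → T_{i-1} ⊕ T_{i+1}`. -/
noncomputable def braid2 (i j m l : Fin (n + 1)) (g f : k[X]) : Mat k :=
  if l = i then
    if j = i then
      if m < i then entry 0 2 (X ^ (gap i m - 1) * (g * f))
      else if i < m then entry 0 1 (-(X ^ (gap i m - 1) * (g * f)))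
      else 0
    else if m < i ∧ i < j then entry 0 0 (X ^ (gap i m - 1) * (g * f))
    else if j < i ∧ i < m then entry 0 0 (-(X ^ (gap i m - 1) * (g * f)))
    else 0
  else 0

noncomputable def braidObjs (k : Type*) [Field k] {n : ℕ} (i : Fin (n + 1)) (h0 : 0 < (i : ℕ))
    (h1 : (i : ℕ) < n) (j : Fin (n + 1)) : Tw k n :=
  if j = i then braidObj k i h0 h1 else stalk k j

noncomputable def braidMap (k : Type*) [Field k] {n : ℕ} (i : Fin (n + 1)) : Family k n
  | 1, x, a => braid1 i (x 0) (x 1) (a 0)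
  | 2, x, a => braid2 i (x 0) (x 1) (x 2) (a 1) (a 0)
  | _, _, _ => 0

lemma stalk_len (j : Fin (n + 1)) : (stalk k j).len = 1 := rfl
lemma stalk_obj (j : Fin (n + 1)) (m : ℕ) : (stalk k j).obj m = j := rfl
lemma stalk_diff (j : Fin (n + 1)) : (stalk k j).diff = 0 := rfl

section
variable (i : Fin (n + 1)) (h0 : 0 < (i : ℕ)) (h1 : (i : ℕ) < n)

lemma braidObj_len : (braidObj k i h0 h1).len = 3 := rfl
lemma braidObj_obj0 : (braidObj k i h0 h1).obj 0 = i := rfl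
lemma braidObj_obj1 : (braidObj k i h0 h1).obj 1 = ⟨i - 1, by omega⟩ := rfl
lemma braidObj_obj2 : (braidObj k i h0 h1).obj 2 = ⟨i + 1, by omega⟩ := rfl
lemma braidObj_diff : (braidObj k i h0 h1).diff = entry 1 0 1 + -entry 2 0 1 := by
  rw [← entry_neg]; rfl
lemma braidObjs_self : braidObjs k i h0 h1 i = braidObj k i h0 h1 := if_pos rfl
lemma braidObjs_ne {j : Fin (n + 1)} (h : j ≠ i) : braidObjs k i h0 h1 j = stalk k j := if_neg h

end

lemma entry_congr (r c : ℕ) {e e' : ℕ} (p : k[X]) (h : e = e') :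
    entry r c (X ^ e * p) = entry r c (X ^ e' * p) := by rw [h]

lemma braid_rel1 (i : Fin (n + 1)) (h0 : 0 < (i : ℕ)) (h1 : (i : ℕ) < n) (j l : Fin (n + 1))
    (f : k[X]) :
    comp (braidObjs k i h0 h1 j) (braidObjs k i h0 h1 l) (braidObjs k i h0 h1 l)
      (braidObjs k i h0 h1 l).diff (braid1 i j l f) =
    comp (braidObjs k i h0 h1 j) (braidObjs k i h0 h1 j) (braidObjs k i h0 h1 l)
      (braid1 i j l f) (braidObjs k i h0 h1 j).diff := by
  have e1 : (i : ℕ) - (i + 1) = 0 := by omega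
  have e2 : (i : ℕ) + 1 - i = 1 := by omega
  have e3 : (i : ℕ) - 1 - i = 0 := by omega
  have e4 : (i : ℕ) - (i - 1) = 1 := by omega
  rcases lt_trichotomy j i with hj | hj | hj <;> rcases lt_trichotomy l i with hl | hl | hl <;>
    (try have hj1 := hj.ne) <;> (try have hj2 := hj.ne') <;> (try have hj3 := hj.not_gt) <;>
    (try have hl1 := hl.ne) <;> (try have hl2 := hl.ne') <;> (try have hl3 := hl.not_gt) <;>
    simp [braid1, *, stalk_obj, stalk_diff, braidObj_len, braidObj_obj0,
      braidObj_obj1, braidObj_obj2, braidObj_diff, braidObjs_self, braidObjs_ne, ne_eq,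
       comp_zero, zero_comp, comp_add, add_comp,
      comp_entry, mul, X_nf2, comp_neg, neg_comp] <;>
    simp (disch := first | omega | (dsimp only; omega)) only [overlap_of_left_le, overlap_of_left_ge, overlap_of_right_le,
        overlap_of_right_ge, e1, e2, e3, e4, pow_zero, pow_one, one_mul,
        Nat.sub_eq_zero_of_le, zero_add] <;> grind

lemma braid_rel2 (i : Fin (n + 1)) (h0 : 0 < (i : ℕ)) (h1 : (i : ℕ) < n) (j m l : Fin (n + 1))
    (g f : k[X]) :
    comp (braidObjs k i h0 h1 j) (braidObjs k i h0 h1 m) (braidObjs k i h0 h1 l)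
      (braid1 i m l g) (braid1 i j m f) =
    comp (braidObjs k i h0 h1 j) (braidObjs k i h0 h1 l) (braidObjs k i h0 h1 l)
      (braidObjs k i h0 h1 l).diff (braid2 i j m l g f) +
    comp (braidObjs k i h0 h1 j) (braidObjs k i h0 h1 j) (braidObjs k i h0 h1 l)
      (braid2 i j m l g f) (braidObjs k i h0 h1 j).diff + braid1 i j l (mul j m l g f) := by
  rcases lt_trichotomy j i with hj | hj | hj <;> rcases lt_trichotomy l i with hl | hl | hl <;>
    rcases lt_trichotomy m i with hm | hm | hm <;>
    (try have hj1 := hj.ne) <;> (try have hj2 := hj.ne') <;> (try have hj3 := hj.not_gt) <;>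
    (try have hl1 := hl.ne) <;> (try have hl2 := hl.ne') <;> (try have hl3 := hl.not_gt) <;>
    (try have hm1 := hm.ne) <;> (try have hm2 := hm.ne') <;> (try have hm3 := hm.not_gt) <;>
    simp [braid1, braid2, *, stalk_len, stalk_obj, stalk_diff, braidObj_len, braidObj_obj0,
      braidObj_obj1, braidObj_obj2, braidObj_diff, braidObjs_self, braidObjs_ne, ne_eq,
       comp_zero, zero_comp, comp_add, add_comp,
      comp_entry, mul, entry_neg, X_nf1, X_nf2, X_nf4, X_nf6, mul_assoc,
      comp_neg, neg_comp] <;>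
    (try simp (disch := first | omega | (dsimp only; omega)) only [overlap_of_left_le,
        overlap_of_left_ge, overlap_of_right_le, overlap_of_right_ge, gap_of_le, gap_of_ge]) <;>
    first
      | exact entry_congr _ _ _ (by omega)
      | exact entry_congr _ _ _ (by simp only [overlap_eq]; omega)
      | exact congrArg₂ (· + ·) (entry_congr _ _ _ (by omega))
          (entry_congr _ _ _ (by omega))
      | grind

lemma braid_rel3 (i : Fin (n + 1)) (h0 : 0 < (i : ℕ)) (h1 : (i : ℕ) < n) (j m l q : Fin (n + 1))
    (h g f : k[X]) :
    comp (braidObjs k i h0 h1 j) (braidObjs k i h0 h1 m) (braidObjs k i h0 h1 q)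
      (braid2 i m l q h g) (braid1 i j m f) -
    comp (braidObjs k i h0 h1 j) (braidObjs k i h0 h1 l) (braidObjs k i h0 h1 q)
      (braid1 i l q h) (braid2 i j m l g f) =
    braid2 i j l q h (mul j m l g f) - braid2 i j m q (mul m l q h g) f := by
  by_cases hq : q = i
  · rcases lt_trichotomy j i with hj | hj | hj <;> rcases lt_trichotomy l i with hl | hl | hl <;>
      rcases lt_trichotomy m i with hm | hm | hm <;>
      (try have hj1 := hj.ne) <;> (try have hj2 := hj.ne') <;> (try have hj3 := hj.not_gt) <;>
      (try have hl1 := hl.ne) <;> (try have hl2 := hl.ne') <;> (try have hl3 := hl.not_gt) <;>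
      (try have hm1 := hm.ne) <;> (try have hm2 := hm.ne') <;> (try have hm3 := hm.not_gt) <;>
      simp [braid1, braid2, *, stalk_len, stalk_obj, braidObj_len, braidObj_obj0,
      braidObj_obj1, braidObj_obj2, braidObjs_self, braidObjs_ne, ne_eq,
       comp_zero, zero_comp, comp_add,
        add_comp, comp_entry, mul, entry_neg, X_nf1, X_nf3, X_nf5, mul_assoc,
        comp_neg, neg_comp] <;>
      (try clear hj1 hj2) <;> (try clear hl1 hl2) <;> (try clear hm1 hm2) <;>
      (try clear hj3) <;> (try clear hl3) <;> (try clear hm3) <;>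
      simp (disch := first | omega | (dsimp only; omega)) only [overlap_of_left_le, overlap_of_left_ge, overlap_of_right_le,
        overlap_of_right_ge, gap_of_le, gap_of_ge] <;>
      first
        | exact entry_congr _ _ _ (by omega)
        | exact (neg_add_eq_zero.2 (entry_congr _ _ _ (by omega))).symm
        | exact (sub_eq_zero.2 (entry_congr _ _ _ (by omega))).symm
        | exact (add_comm _ _).trans (congrArg₂ (· + ·) (entry_congr _ _ _ (by omega))
            (entry_congr _ _ _ (by omega)))
        | exact (congrArg₂ (· + ·) (congrArg _ (entry_congr _ _ _ (by omega)))
            (congrArg _ (entry_congr _ _ _ (by omega)))).trans (sub_eq_add_neg _ _).symm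
  · have e2 : ∀ g f : k[X], braid2 i m l q g f = 0 := fun g f => if_neg hq
    have e3 : braid2 i j l q h (mul j m l g f) = 0 := if_neg hq
    have e4 : braid2 i j m q (mul m l q h g) f = 0 := if_neg hq
    rw [e2, e3, e4, zero_comp, sub_zero, zero_sub, neg_eq_zero]
    by_cases hl : l = i
    · have e1 : ∃ p p' : k[X], braid1 i l q h = entry 0 1 p + entry 0 2 p' := by
        simp only [braid1, if_pos hl, if_neg hq]
        split_ifs <;> exact ⟨_, _, rfl⟩
      obtain ⟨p, p', e1⟩ := e1
      rw [e1]
      simp only [braid2, if_pos hl]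
      split_ifs <;> simp [add_comp, comp_entry, comp_zero]
    · simp [braid2, hl, comp_zero]

lemma multilinear_one {F : k[X] → Mat k} (φ : (Fin 1 → k[X]) → Mat k)
    (h : ∀ a, φ a = F (a 0)) (hadd : ∀ f g, F (f + g) = F f + F g)
    (hsmul : ∀ (c : k) f, F (c • f) = c • F f) :
    ∃ f : MultilinearMap k (fun _ : Fin 1 => k[X]) (Mat k), ∀ a, φ a = f a := by
  refine ⟨MultilinearMap.mk (fun a => F (a 0)) ?_ ?_, h⟩
  · intro _ m p f g
    obtain rfl : p = 0 := Subsingleton.elim _ _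
    simp [hadd]
  · intro _ m p c f
    obtain rfl : p = 0 := Subsingleton.elim _ _
    simp [hsmul]

lemma multilinear_two {F : k[X] → Mat k} (φ : (Fin 2 → k[X]) → Mat k)
    (h : ∀ a, φ a = F (a 1 * a 0)) (hadd : ∀ f g, F (f + g) = F f + F g)
    (hsmul : ∀ (c : k) f, F (c • f) = c • F f) :
    ∃ f : MultilinearMap k (fun _ : Fin 2 => k[X]) (Mat k), ∀ a, φ a = f a := by
  refine ⟨MultilinearMap.mk (fun a => F (a 1 * a 0)) ?_ ?_, h⟩
  · intro _ m p f g
    fin_cases p <;> simp [add_mul, mul_add, hadd]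
  · intro _ m p c f
    fin_cases p <;> simp [hsmul]

lemma Family.low_eq_zero {φ : Family k n} {K d : ℕ} (h : ∀ e, K < e → φ e = 0) {p : Fin (d + 1)}
    (hp : K < (p : ℕ)) (x : Fin (d + 1) → Fin (n + 1)) (a : Fin d → k[X]) : φ.low p x a = 0 := by
  rw [Family.low, h _ hp]; rfl

lemma Family.up_eq_zero {φ : Family k n} {K d : ℕ} (h : ∀ e, K < e → φ e = 0) {p : Fin (d + 1)}
    (hp : K < d - (p : ℕ)) (x : Fin (d + 1) → Fin (n + 1)) (a : Fin d → k[X]) :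
    φ.up p x a = 0 := by
  rw [Family.up, h _ hp]; rfl

lemma Family.insertMul_eq_zero {φ : Family k n} {K d : ℕ} (h : ∀ e, K < e → φ e = 0)
    (hd : K + 1 < d) (ε : ℤ) (x : Fin (d + 1) → Fin (n + 1)) (a : Fin d → k[X]) :
    φ.insertMul ε d x a = 0 := by
  obtain _ | d := d
  · rfl
  · simp [Family.insertMul, h d (by omega)]

lemma comp_up_low_eq_zero {φ : Family k n} {K d : ℕ} (h : ∀ e, K < e → φ e = 0)
    (p : Fin (d + 1)) (hp : K < (p : ℕ) ∨ K < d - (p : ℕ)) (W Y Z : Tw k n)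
    (x : Fin (d + 1) → Fin (n + 1)) (a : Fin d → k[X]) :
    comp W Y Z (φ.up p x a) (φ.low p x a) = 0 := by
  rcases hp with hp | hp
  · rw [Family.low_eq_zero h hp, comp_zero]
  · rw [Family.up_eq_zero h hp, zero_comp]

/-- The identity functor, restricted to the generators: `T_j ↦ T_j`, with `F¹` the identity and
`F^d = 0` for `d ≠ 1`. -/
noncomputable def inclMap (k : Type*) [Field k] (n : ℕ) : Family k n
  | 1, _, a => entry 0 0 (a 0)
  | _, _, _ => 0

noncomputable def incl (k : Type*) [Field k] (n : ℕ) : AInfFunctor k n where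
  obj := stalk k
  map := inclMap k n
  map_zero _ _ := rfl
  multilinear := by
    intro d x
    match d with
    | 0 => exact ⟨0, fun _ => rfl⟩
    | 1 => exact multilinear_one _ (fun _ => rfl) (entry_add 0 0) (entry_smul 0 0)
    | d + 2 => exact ⟨0, fun _ => rfl⟩
  degree := by
    intro d x a
    match d with
    | 0 => exact Submodule.zero_mem _
    | 1 => exact entry_mem _ Nat.one_pos Nat.one_pos rfl
    | d + 2 => exact Submodule.zero_mem _
  relation := by
    intro d x a
    match d with
    | 0 => simp [mu1, mu2, Family.up, Family.low, Family.insertMul, inclMap, comp_zero, zero_comp]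
    | 1 =>
      simp [mu1, mu2, Family.up, Family.low, Family.insertMul, inclMap, comp_zero, zero_comp,
        Fin.sum_univ_succ, stalk_diff]
    | 2 =>
      simp [mu1, mu2, Family.up, Family.low, Family.insertMul, inclMap, comp_zero,
        Fin.sum_univ_succ, stalk_diff, comp_entry, stalk_len, stalk_obj]
    | d + 3 =>
      have h : ∀ e, 1 < e → inclMap k n e = 0 := fun e he => by
        obtain _ | _ | e := e
        · omega
        · omega
        · rfl
      rw [Family.insertMul_eq_zero h (by omega), h _ (by omega)]
      simp only [mu2]
      rw [Finset.sum_eq_zero fun p _ => by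
        rw [comp_up_low_eq_zero h p (by omega), smul_zero]]
      simp [mu1, comp_zero, zero_comp]

lemma braid_rel4 (i : Fin (n + 1)) (h0 : 0 < (i : ℕ)) (h1 : (i : ℕ) < n) (j m l q r : Fin (n + 1))
    (h' h g f : k[X]) :
    comp (braidObjs k i h0 h1 j) (braidObjs k i h0 h1 l) (braidObjs k i h0 h1 r)
      (braid2 i l q r h' h) (braid2 i j m l g f) = 0 := by
  unfold braid2
  split_ifs <;> simp [comp_zero, zero_comp, comp_entry]

/-- The functor `β_i^-` on the generators, for `0 < i < n`. -/
noncomputable def negBraid (k : Type*) [Field k] {n : ℕ} (i : Fin (n + 1)) (h0 : 0 < (i : ℕ))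
    (h1 : (i : ℕ) < n) : AInfFunctor k n where
  obj := braidObjs k i h0 h1
  map := braidMap k i
  map_zero _ _ := rfl
  multilinear := by
    intro d x
    match d with
    | 0 => exact ⟨0, fun _ => rfl⟩
    | 1 =>
      refine multilinear_one (F := braid1 i (x 0) (x 1)) _ (fun _ => rfl) (fun f g => ?_)
        (fun c f => ?_)
      · simp only [braid1]
        split_ifs <;> simp only [entry_add, mul_add] <;> abel
      · simp only [braid1]
        split_ifs <;> simp only [entry_smul, mul_smul_comm, smul_add]
    | 2 =>
      refine multilinear_two (F := fun f => braid2 i (x 0) (x 1) (x 2) 1 f) _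
        (fun _ => by simp [braidMap, braid2]) (fun f g => ?_) (fun c f => ?_)
      · simp only [braid2, one_mul]
        split_ifs <;> simp only [entry_add, entry_neg, mul_add, neg_add, add_zero]
      · simp only [braid2, one_mul]
        split_ifs <;> simp only [entry_smul, entry_neg, mul_smul_comm, smul_neg, smul_zero]
    | d + 3 => exact ⟨0, fun _ => rfl⟩
  degree := by
    intro d x a
    match d with
    | 0 => exact Submodule.zero_mem _
    | 1 =>
      simp only [braidMap, braid1]
      split_ifs <;> (repeat' apply Submodule.add_mem) <;> apply entry_mem <;>
        simp_all [braidObjs, braidObj, stalk, Fin.last]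
    | 2 =>
      simp only [braidMap, braid2]
      split_ifs <;> (first | exact Submodule.zero_mem _ | apply entry_mem) <;>
        simp_all [braidObjs, braidObj, stalk, Fin.last]
    | d + 3 => exact Submodule.zero_mem _
  relation := by
    intro d x a
    match d with
    | 0 => simp [mu1, mu2, Family.up, Family.low, Family.insertMul, braidMap, comp_zero, zero_comp]
    | 1 =>
      simp [mu1, mu2, Family.up, Family.low, Family.insertMul, braidMap, comp_zero, zero_comp,
        Fin.sum_univ_succ, sub_eq_zero]
      exact braid_rel1 i h0 h1 _ _ _
    | 2 =>
      have h := braid_rel2 i h0 h1 (x 0) (x 1) (x 2) (a 1) (a 0)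
      simp [mu1, mu2, Family.up, Family.low, Family.insertMul, braidMap, comp_zero, zero_comp,
        Fin.sum_univ_succ]
      rw [h]
      abel
    | 3 =>
      have h := braid_rel3 i h0 h1 (x 0) (x 1) (x 2) (x 3) (a 2) (a 1) (a 0)
      simp [mu1, mu2, Family.up, Family.low, Family.insertMul, braidMap, comp_zero, zero_comp,
        Fin.sum_univ_succ]
      exact (sub_eq_add_neg _ _).symm.trans (h.trans (sub_eq_add_neg _ _))
    | d + 4 =>
      have h : ∀ e, 2 < e → braidMap k i e = 0 := fun e he => by
        obtain _ | _ | _ | e := e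
        · omega
        · omega
        · omega
        · rfl
      rw [Family.insertMul_eq_zero h (by omega), h _ (by omega)]
      simp only [mu2]
      rw [Finset.sum_eq_zero fun p _ => by
        by_cases hp : 2 < (p : ℕ) ∨ 2 < d + 4 - (p : ℕ)
        · rw [comp_up_low_eq_zero h p hp, smul_zero]
        · obtain rfl : d = 0 := by omega
          obtain rfl : p = 2 := by apply Fin.ext; show (p : ℕ) = 2; omega
          exact (congrArg _ (braid_rel4 i h0 h1 _ _ _ _ _ _ _ _ _)).trans (smul_zero _)]
      simp [mu1, comp_zero, zero_comp]


/-!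
## The explicit transformations of degree 1

`σ = {σ_ℓ}_{ℓ ≥ 0}` is an element of `⨁_{ℓ ≥ 0} k`, that is, a finitely supported sequence.
-/

/-- `∑_ℓ (1/2) σ_ℓ s^{e + ℓ}`. -/
noncomputable def halfSum (σ : ℕ →₀ k) (e : ℕ) : k[X] :=
  σ.sum fun ℓ c => C (2⁻¹ * c) * X ^ (e + ℓ)

/-- `∑_ℓ (1/2) σ_ℓ s^{e + ℓ - 1}`. Where this is used with `e = 0`, its coefficient vanishes, so
the value of the truncated exponent `0 + 0 - 1` does not matter. -/
noncomputable def halfSumPred (σ : ℕ →₀ k) (e : ℕ) : k[X] :=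
  σ.sum fun ℓ c => C (2⁻¹ * c) * X ^ (e + ℓ - 1)

/-- The value of `η¹` on `a_{lj} s^α : T_j → T_l`. -/
noncomputable def eta1 (i : Fin (n + 1)) (σ : ℕ →₀ k) (j l : Fin (n + 1)) (α : ℕ) : Mat k :=
  if l ≠ i then entry 0 0 ((qdeg l j α : k) • halfSum σ α)
  else if j < i then entry 1 0 ((qdeg i j α : k) • halfSum σ α)
  else if i < j then entry 2 0 ((qdeg i j α : k) • halfSum σ α)
  else entry 1 0 ((qdeg i i α : k) • (2⁻¹ : k) • halfSumPred σ α)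
    + entry 2 0 ((qdeg i i α : k) • (2⁻¹ : k) • halfSumPred σ α)

/-- The coefficient `𝔔(a_{im} s^β, a_{mj} s^α)`; the product of the two morphisms is
`a_{ij} s^{β + α + δ(j,m,i)}`. -/
noncomputable def coeffQ (k : Type*) [Field k] (i j m : Fin (n + 1)) (β α : ℕ) : k :=
  if (m < i ∧ i < j) ∨ (j < i ∧ i < m) then
    (sgn i m : k) * (qdeg i j (β + α + overlap j m i) : k)
  else if m = i then (sgn j i : k) * 2⁻¹ * (qdeg i m β : k)
  else if j = i then (sgn i m : k) * 2⁻¹ * (qdeg i j (β + α + overlap j m i) : k)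
  else 0

/-- The value of `η²` on `a_{lm} s^β : T_m → T_l` and `a_{mj} s^α : T_j → T_m`. -/
noncomputable def eta2 (i : Fin (n + 1)) (σ : ℕ →₀ k) (j m l : Fin (n + 1)) (β α : ℕ) : Mat k :=
  if l = i then entry 0 0 (coeffQ k i j m β α • halfSumPred σ (β + α + overlap j m i)) else 0

end

end KLRW

namespace KLRW
section
variable {k : Type*} [Field k] {n : ℕ}

/-! Sending `f : T_j → T_l` to `X ^ (l - j) * f`, with truncated subtraction, turns the product of
`𝒞` into the product of `k[s]` (`X_pow_mul_mul`), so that `𝒞` sits inside a commutative domain. The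
complex `Hom(T_j, β T_l)` lives in degrees `-1` and `0`. Its differential is injective, with left
inverse `retr`, and its cokernel embeds in `k[s]` by `proj`, compatibly with composition on both
sides (`eq_diff_comp_retr`, `proj_entry_comp`, `proj_braid1_comp`).

For degree reasons a natural transformation of degree `1` is therefore a pair `(η¹, η²)`, where `η²`
lifts through this differential the failure of `η¹` to be a derivation. Injectivity makes `η²`
unique and gives the equation of arity `3` for free (`cocycle_of_dcomp_eq_leibniz`). So the
cohomology consists of the derivations of `𝒞` with values in a bimodule inside `k[s]`, modulo inner
ones.

In the embedding, `𝔮` becomes twice the exponent plus `j - l`, the eigenvalue of the Euler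
derivation `E = 2 s d/ds + (j - l)`. Every multiple `p E` is a derivation; it lifts to `etaOne`, and
`etaTwo` completes it. Conversely (`exists_eq_euler_add_inner`), a derivation `D` takes `s ∈
End(T_i)` to a multiple of `s`, since the bimodule at `(i, i)` is `s k[s]`. With `p = D(s) / 2s`,
the difference `D - p E` kills `s` on `T_i`, hence on every `T_j` because `s` is central, so it is
`k[s]`-linear. Its values on the `a_{lj}` are then differences of a potential, which makes it inner.
The polynomial `p` is unique because inner derivations kill endomorphisms in a commutative ring,
while `p E(s) = 2 p s`. The sequence `σ` corresponds to `p = ∑ ½ σ_ℓ s^ℓ`. -/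

/-! ### The embedding of `𝒞` into `k[s]`, and composition of matrices. -/

lemma overlap_add_sub (j m l : Fin (n + 1)) :
    overlap j m l + ((l : ℕ) - (j : ℕ)) = ((l : ℕ) - (m : ℕ)) + ((m : ℕ) - (j : ℕ)) := by
  rw [overlap_eq]; omega

/-- The overlap is the coboundary of the truncated difference `(l - j)⁺`, so rescaling by these
powers of `s` removes it. -/
lemma X_pow_mul_mul (j m l : Fin (n + 1)) (g f : k[X]) :
    X ^ ((l : ℕ) - (j : ℕ)) * mul j m l g f =
      (X ^ ((l : ℕ) - (m : ℕ)) * g) * (X ^ ((m : ℕ) - (j : ℕ)) * f) := by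
  rw [mul, ← mul_assoc, ← pow_add, add_comm, overlap_add_sub, pow_add]; ring

/-- Associativity is inherited from `k[s]`, where the rescaling power of `X` can be cancelled. -/
lemma mul_assoc' (j m l q : Fin (n + 1)) (h g f : k[X]) :
    mul j m q (mul m l q h g) f = mul j l q h (mul j m l g f) := by
  have hX : (X : k[X]) ^ ((q : ℕ) - (j : ℕ)) ≠ 0 := pow_ne_zero _ X_ne_zero
  apply mul_left_cancel₀ hX
  simp only [X_pow_mul_mul, mul_assoc]

lemma mul_sum' {ι : Type*} (s : Finset ι) (i j l : Fin (n + 1)) (b : k[X]) (a : ι → k[X]) :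
    mul i j l b (∑ m ∈ s, a m) = ∑ m ∈ s, mul i j l b (a m) := by
  simp only [mul, Finset.mul_sum]

lemma sum_mul' {ι : Type*} (s : Finset ι) (i j l : Fin (n + 1)) (b : ι → k[X]) (a : k[X]) :
    mul i j l (∑ m ∈ s, b m) a = ∑ m ∈ s, mul i j l (b m) a := by
  simp only [mul, Finset.mul_sum, Finset.sum_mul]

lemma comp_assoc (V W Y Z : Tw k n) (h g f : Mat k) :
    comp V W Z (comp W Y Z h g) f = comp V Y Z h (comp V W Y g f) := by
  funext r c
  simp only [comp, mul_sum', sum_mul', mul_assoc']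
  exact Finset.sum_comm

lemma comp_sub (W Y Z : Tw k n) (g f f' : Mat k) :
    comp W Y Z g (f - f') = comp W Y Z g f - comp W Y Z g f' := by
  rw [sub_eq_add_neg, comp_add, comp_neg, sub_eq_add_neg]

lemma sub_comp (W Y Z : Tw k n) (g g' f : Mat k) :
    comp W Y Z (g - g') f = comp W Y Z g f - comp W Y Z g' f := by
  rw [sub_eq_add_neg, add_comp, neg_comp, sub_eq_add_neg]

lemma comp_mem {W Y Z : Tw k n} {p q : ℤ} {g f : Mat k} (hg : g ∈ TwHom q Y Z)
    (hf : f ∈ TwHom p W Y) : comp W Y Z g f ∈ TwHom (q + p) W Z := by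
  intro r c h
  obtain ⟨m, -, hm⟩ := Finset.exists_ne_zero_of_sum_ne_zero h
  have h1 := hg r m fun h => hm (by rw [h, zero_mul'])
  have h2 := hf m c fun h => hm (by rw [h, mul_zero'])
  exact ⟨h1.1, h2.2.1, by omega⟩

lemma diff_mem (Y : Tw k n) : Y.diff ∈ TwHom 1 Y Y := Y.diff_deg

/-! ### The complexes `Hom(T_j, β T_l)` and their cohomology. -/

variable (i : Fin (n + 1)) (h0 : 0 < (i : ℕ)) (h1 : (i : ℕ) < n)

lemma ext_of_ne {p : ℤ} {j l : Fin (n + 1)} (hl : l ≠ i) {f : Mat k}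
    (hf : f ∈ TwHom p (stalk k j) (braidObjs k i h0 h1 l)) : f = entry 0 0 (f 0 0) := by
  funext r c
  rw [entry_apply]
  split_ifs with h
  · rw [h.1, h.2]
  · by_contra h'
    have := hf r c h'
    rw [braidObjs_ne i h0 h1 hl, stalk_len, stalk_len] at this
    omega

lemma eq_zero_of_ne {p : ℤ} (hp : p ≠ 0) {j l : Fin (n + 1)} (hl : l ≠ i) {f : Mat k}
    (hf : f ∈ TwHom p (stalk k j) (braidObjs k i h0 h1 l)) : f = 0 := by
  funext r c
  by_contra h'
  have := hf r c h'
  rw [braidObjs_ne i h0 h1 hl] at this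
  simp only [stalk] at this
  omega

lemma ext_zero_of_eq {j : Fin (n + 1)} {f : Mat k}
    (hf : f ∈ TwHom 0 (stalk k j) (braidObjs k i h0 h1 i)) :
    f = entry 1 0 (f 1 0) + entry 2 0 (f 2 0) := by
  funext r c
  by_cases h' : f r c = 0
  · simp only [Pi.add_apply, entry_apply]
    split_ifs with h h2 h2
    · omega
    · rw [← h.1, ← h.2, h', add_zero]
    · rw [← h2.1, ← h2.2, h', add_zero]
    · rw [h', add_zero]
  have := hf r c h'
  rw [braidObjs_self] at this
  simp only [stalk, braidObj] at this
  obtain rfl : c = 0 := by omega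
  obtain rfl | rfl | rfl : r = 0 ∨ r = 1 ∨ r = 2 := by omega
  · simp at this
  · simp [entry_apply]
  · simp [entry_apply]

lemma ext_neg_one_of_eq {j : Fin (n + 1)} {f : Mat k}
    (hf : f ∈ TwHom (-1) (stalk k j) (braidObjs k i h0 h1 i)) : f = entry 0 0 (f 0 0) := by
  funext r c
  rw [entry_apply]
  split_ifs with h
  · rw [h.1, h.2]
  · by_contra h'
    have := hf r c h'
    rw [braidObjs_self] at this
    simp only [stalk, braidObj] at this
    obtain rfl : c = 0 := by omega
    obtain rfl | rfl | rfl : r = 0 ∨ r = 1 ∨ r = 2 := by omega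
    all_goals simp at this
    exact h ⟨rfl, rfl⟩

/-- The components of `β T_l` have degrees `0` and `-1` only. This bounds the arities in which a
transformation can be nonzero. -/
lemma hom_eq_zero {p : ℤ} (hp : p ≠ 0) (hp' : p ≠ -1) {j l : Fin (n + 1)} {f : Mat k}
    (hf : f ∈ TwHom p (stalk k j) (braidObjs k i h0 h1 l)) : f = 0 := by
  by_cases hl : l = i
  · subst hl
    funext r c
    by_contra h'
    have := hf r c h'
    rw [braidObjs_self] at this
    simp only [stalk, braidObj] at this
    split_ifs at this <;> omega
  · exact eq_zero_of_ne i h0 h1 hp hl hf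

/-- The image of a morphism `T_j → β T_l` of degree `0` in the cokernel of the differential of
`Hom(T_j, β T_l)`, where the cokernel is embedded in `k[s]` compatibly with compositions. -/
noncomputable def proj (j l : Fin (n + 1)) : Mat k →ₗ[k] k[X] where
  toFun f :=
    -- Both rows carry the weight of the embedding; the extra `X` on the row `T_{i-1}` makes the two
    -- images of the differential cancel and matches the extra `s` in `β¹`.
    if l = i then X * (X ^ ((i : ℕ) - 1 - (j : ℕ)) * f 1 0) + X ^ ((i : ℕ) + 1 - (j : ℕ)) * f 2 0
    else X ^ ((l : ℕ) - (j : ℕ)) * f 0 0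
  map_add' f g := by
    split_ifs <;> simp only [Pi.add_apply] <;> ring
  map_smul' c f := by
    split_ifs <;> simp only [Pi.smul_apply, mul_smul_comm, smul_add, RingHom.id_apply]

lemma proj_self (j : Fin (n + 1)) (f : Mat k) : proj i j i f =
    X * (X ^ ((i : ℕ) - 1 - (j : ℕ)) * f 1 0) + X ^ ((i : ℕ) + 1 - (j : ℕ)) * f 2 0 := if_pos rfl

lemma proj_ne (j : Fin (n + 1)) {l : Fin (n + 1)} (hl : l ≠ i) (f : Mat k) :
    proj i j l f = X ^ ((l : ℕ) - (j : ℕ)) * f 0 0 := if_neg hl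

lemma proj_entry_comp (j m l : Fin (n + 1)) (f : Mat k) (a : k[X]) :
    proj i j l (comp (stalk k j) (stalk k m) (braidObjs k i h0 h1 l) f (entry 0 0 a)) =
      proj i m l f * (X ^ ((m : ℕ) - (j : ℕ)) * a) := by
  by_cases hl : l = i
  · subst hl
    have e1 := X_pow_mul_mul j m ⟨l - 1, by omega⟩ (f 1 0) a
    have e2 := X_pow_mul_mul j m ⟨l + 1, by omega⟩ (f 2 0) a
    simp only [proj_self, braidObjs_self, comp, stalk_len, stalk_obj, Finset.sum_range_one,
      entry_apply, braidObj_obj1, braidObj_obj2, and_self, if_true]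
    dsimp only at e1 e2
    rw [e1, e2]; ring
  · simp only [proj_ne i _ hl, braidObjs_ne i h0 h1 hl, comp, stalk_len, stalk_obj,
      Finset.sum_range_one, entry_apply, and_self, if_true]
    rw [X_pow_mul_mul]

/-- For `m = i ≠ l`, passing through `T_{i-1}` or `T_{i+1}` changes the weight `(l - i)⁺`, and the
factor `s` that `β¹` puts on one of the two entries is exactly the correction. -/
lemma proj_braid1_comp (j m l : Fin (n + 1)) (g : k[X]) (f : Mat k) :
    proj i j l (comp (stalk k j) (braidObjs k i h0 h1 m) (braidObjs k i h0 h1 l)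
      (braid1 i m l g) f) = (X ^ ((l : ℕ) - (m : ℕ)) * g) * proj i j m f := by
  by_cases hl : l = i <;> by_cases hm : m = i
  · subst hl; subst hm
    have e1 := X_pow_mul_mul j ⟨m - 1, by omega⟩ ⟨m - 1, by omega⟩ g (f 1 0)
    have e2 := X_pow_mul_mul j ⟨m + 1, by omega⟩ ⟨m + 1, by omega⟩ g (f 2 0)
    dsimp only at e1 e2
    simp only [proj_self, braidObjs_self, comp, braidObj_len, stalk_obj, Finset.sum_range_succ,
      Finset.sum_range_zero, entry_apply, braidObj_obj0, braidObj_obj1, braidObj_obj2, braid1,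
      Pi.add_apply, if_true]
    simp [zero_mul', e1, e2]
    ring
  · subst hl
    simp only [proj_self, braidObjs_self, braidObjs_ne l h0 h1 hm, proj_ne l _ hm, comp, stalk_len,
      stalk_obj, Finset.sum_range_one, braid1, if_neg hm, if_true, braidObj_obj1, braidObj_obj2]
    split_ifs with h
    · have e2 := X_pow_mul_mul j m ⟨l + 1, by omega⟩ g (f 0 0)
      dsimp only at e2
      have h3 : (l : ℕ) + 1 - m = l - m := by omega
      simp [entry_apply, zero_mul', e2, h3]
    · have h' : m < l := lt_of_le_of_ne (not_lt.1 h) hm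
      have e1 := X_pow_mul_mul j m ⟨l - 1, by omega⟩ g (f 0 0)
      dsimp only at e1
      have h3 : (l : ℕ) - m = l - 1 - m + 1 := by omega
      simp [entry_apply, zero_mul', e1, h3]
      ring
  · subst hm
    have e1 := fun p : k[X] => X_pow_mul_mul j ⟨m - 1, by omega⟩ l p (f 1 0)
    have e2 := fun p : k[X] => X_pow_mul_mul j ⟨m + 1, by omega⟩ l p (f 2 0)
    dsimp only at e1 e2
    simp only [proj_self, braidObjs_self, braidObjs_ne m h0 h1 hl, proj_ne m _ hl, comp,
      braidObj_len, stalk_obj, Finset.sum_range_succ, Finset.sum_range_zero, braid1, if_neg hl,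
      if_true, braidObj_obj0, braidObj_obj1, braidObj_obj2]
    split_ifs with h
    · simp [entry_apply, zero_mul', mul_add, e1, e2]
      have h3 : (l : ℕ) - (m - 1) = l - m + 1 := by omega
      have h4 : (l : ℕ) - m = l - (m + 1) + 1 := by omega
      rw [h3, h4]
      ring
    · have h' : l < m := lt_of_le_of_ne (not_lt.1 h) hl
      simp [entry_apply, zero_mul', mul_add, e1, e2]
      have h3 : (l : ℕ) - (m - 1) = 0 := by omega
      have h4 : (l : ℕ) - m = 0 := by omega
      have h5 : (l : ℕ) - (m + 1) = 0 := by omega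
      rw [h3, h4, h5]
      ring
  · simp only [braidObjs_ne i h0 h1 hl, proj_ne i _ hl, braidObjs_ne i h0 h1 hm, proj_ne i _ hm,
      comp, stalk_len, stalk_obj, Finset.sum_range_one, braid1, if_neg hm, if_neg hl, entry_apply,
      and_self, if_true]
    rw [X_pow_mul_mul]

/-- A left inverse of the differential `Hom^{-1}(T_j, β T_l) → Hom^0(T_j, β T_l)`. -/
noncomputable def retr (j l : Fin (n + 1)) : Mat k →ₗ[k] Mat k where
  -- The row that is read is one on which the differential is multiplication by `±1`: `T_{i-1}` for
  -- `j > i`, and `T_{i+1}` for `j ≤ i`.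
  toFun f := if l = i then entry 0 0 (if i < j then f 1 0 else - f 2 0) else 0
  map_add' f g := by
    split_ifs <;> simp only [Pi.add_apply, ← entry_add, neg_add, add_zero]
  map_smul' c f := by
    split_ifs <;> simp only [Pi.smul_apply, ← entry_smul, smul_neg, RingHom.id_apply, smul_zero]

lemma retr_mem (j l : Fin (n + 1)) (f : Mat k) :
    retr i j l f ∈ TwHom (-1) (stalk k j) (braidObjs k i h0 h1 l) := by
  by_cases hl : l = i
  · subst hl
    rw [braidObjs_self]
    simp only [retr, LinearMap.coe_mk, AddHom.coe_mk, if_true]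
    exact entry_mem _ (by decide : 0 < 3) Nat.one_pos rfl
  · simp only [retr, LinearMap.coe_mk, AddHom.coe_mk, if_neg hl]
    exact Submodule.zero_mem _

lemma braidObjs_diff_ne {l : Fin (n + 1)} (hl : l ≠ i) : (braidObjs k i h0 h1 l).diff = 0 := by
  rw [braidObjs_ne i h0 h1 hl, stalk_diff]

/-- The truncated exponents are `1` for `j < i`, respectively `j > i`, and `0` otherwise. At least
one of them vanishes, which is why the differential splits. -/
lemma diff_comp_entry (j : Fin (n + 1)) (f : k[X]) :
    comp (stalk k j) (braidObjs k i h0 h1 i) (braidObjs k i h0 h1 i)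
      (braidObjs k i h0 h1 i).diff (entry 0 0 f) =
    entry 1 0 (X ^ ((i : ℕ) - max (j : ℕ) (i - 1)) * f) -
      entry 2 0 (X ^ (min (j : ℕ) (i + 1) - (i : ℕ)) * f) := by
  rw [braidObjs_self, braidObj_diff, add_comp, neg_comp, comp_entry, comp_entry, sub_eq_add_neg]
  simp only [braidObj_len, stalk_obj, braidObj_obj0, braidObj_obj1, braidObj_obj2, mul, one_mul,
    overlap_eq]
  rw [if_pos ⟨trivial, by decide⟩, if_pos ⟨trivial, by decide⟩]
  have e1 : (i : ℕ) - max (j : ℕ) (i - 1) + (min (j : ℕ) (i - 1) - i) =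
      (i : ℕ) - max (j : ℕ) (i - 1) := by omega
  have e2 : (i : ℕ) - max (j : ℕ) (i + 1) + (min (j : ℕ) (i + 1) - i) =
      min (j : ℕ) (i + 1) - i := by omega
  rw [e1, e2]

lemma retr_diff_comp {j l : Fin (n + 1)} {f : Mat k}
    (hf : f ∈ TwHom (-1) (stalk k j) (braidObjs k i h0 h1 l)) :
    retr i j l (comp (stalk k j) (braidObjs k i h0 h1 l) (braidObjs k i h0 h1 l)
      (braidObjs k i h0 h1 l).diff f) = f := by
  by_cases hl : l = i
  · subst hl
    rw [ext_neg_one_of_eq l h0 h1 hf, diff_comp_entry]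
    simp only [retr, LinearMap.coe_mk, AddHom.coe_mk, if_true, Pi.sub_apply]
    split_ifs with h
    · have h3 : (l : ℕ) - max (j : ℕ) (l - 1) = 0 := by omega
      simp [h3, entry_apply]
    · have h3 : min (j : ℕ) (l + 1) - (l : ℕ) = 0 := by omega
      simp [h3, entry_apply]
  · rw [eq_zero_of_ne i h0 h1 (by decide) hl hf, comp_zero, map_zero]

lemma proj_diff_comp (j l : Fin (n + 1)) (f : Mat k) :
    proj i j l (comp (stalk k j) (braidObjs k i h0 h1 l) (braidObjs k i h0 h1 l)
      (braidObjs k i h0 h1 l).diff f) = 0 := by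
  by_cases hl : l = i
  · subst hl
    rw [proj_self]
    have e1 := X_pow_mul_mul j l ⟨l - 1, by omega⟩ 1 (f 0 0)
    have e2 := X_pow_mul_mul j l ⟨l + 1, by omega⟩ (-1) (f 0 0)
    dsimp only at e1 e2
    simp only [braidObjs_self, comp, stalk_obj, Finset.sum_range_succ, Finset.sum_range_zero,
      braidObj, Pi.add_apply, entry_apply]
    have e3 : (l : ℕ) - 1 - l = 0 := by omega
    have e4 : (l : ℕ) + 1 - l = 1 := by omega
    simp [zero_mul', e1, e2, e3, e4]
  · rw [braidObjs_diff_ne i h0 h1 hl, zero_comp, map_zero]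

/-- After a power of `X` is cancelled, the vanishing of `proj` expresses one row as minus `1` or `X`
times the row read by `retr`. Hence the kernel of `proj` is the image of the differential. -/
lemma eq_diff_comp_retr {j l : Fin (n + 1)} {f : Mat k}
    (hf : f ∈ TwHom 0 (stalk k j) (braidObjs k i h0 h1 l)) (h : proj i j l f = 0) :
    comp (stalk k j) (braidObjs k i h0 h1 l) (braidObjs k i h0 h1 l)
      (braidObjs k i h0 h1 l).diff (retr i j l f) = f := by
  by_cases hl : l = i
  · subst hl
    rw [proj_self] at h
    conv_rhs => rw [ext_zero_of_eq l h0 h1 hf]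
    simp only [retr, LinearMap.coe_mk, AddHom.coe_mk, if_true]
    rw [diff_comp_entry, sub_eq_add_neg, ← entry_neg]
    rcases lt_trichotomy j l with hj | hj | hj
    · have e1 : (l : ℕ) - max (j : ℕ) (l - 1) = 1 := by omega
      have e2 : min (j : ℕ) (l + 1) - (l : ℕ) = 0 := by omega
      have e3 : (l : ℕ) + 1 - j = l - 1 - j + 2 := by omega
      have h' : X ^ ((l : ℕ) - 1 - j + 1) * (f 1 0 + X * f 2 0) = 0 := by
        rw [← h, e3]; ring
      have h'' := (mul_eq_zero.1 h').resolve_left (pow_ne_zero _ X_ne_zero)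
      rw [eq_neg_of_add_eq_zero_left h'', if_neg hj.not_gt, e1, e2]
      simp
    · subst hj
      have e1 : (j : ℕ) - max (j : ℕ) (j - 1) = 0 := by omega
      have e2 : min (j : ℕ) (j + 1) - (j : ℕ) = 0 := by omega
      have e3 : (j : ℕ) + 1 - j = 1 := by omega
      have e4 : (j : ℕ) - 1 - j = 0 := by omega
      have h' : X * (f 1 0 + f 2 0) = 0 := by
        rw [← h, e3, e4]; ring
      have h'' := (mul_eq_zero.1 h').resolve_left X_ne_zero
      rw [eq_neg_of_add_eq_zero_left h'', if_neg (lt_irrefl _), e1, e2]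
      simp
    · have e1 : (l : ℕ) - max (j : ℕ) (l - 1) = 0 := by omega
      have e2 : min (j : ℕ) (l + 1) - (l : ℕ) = 1 := by omega
      have e3 : (l : ℕ) + 1 - j = 0 := by omega
      have e4 : (l : ℕ) - 1 - j = 0 := by omega
      rw [e3, e4, pow_zero, one_mul, one_mul] at h
      rw [eq_neg_of_add_eq_zero_right h, if_pos hj, e1, e2]
      simp
  · rw [braidObjs_diff_ne i h0 h1 hl, zero_comp]
    rw [proj_ne i j hl] at h
    rw [ext_of_ne i h0 h1 hl hf, (mul_eq_zero.1 h).resolve_left (pow_ne_zero _ X_ne_zero),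
      entry_zero]

lemma eq_zero_of_diff_comp {j l : Fin (n + 1)} {f : Mat k}
    (hf : f ∈ TwHom (-1) (stalk k j) (braidObjs k i h0 h1 l))
    (h : comp (stalk k j) (braidObjs k i h0 h1 l) (braidObjs k i h0 h1 l)
      (braidObjs k i h0 h1 l).diff f = 0) : f = 0 := by
  rw [← retr_diff_comp i h0 h1 hf, h, map_zero]

end

/-! ### The differential of transformations, arity by arity. -/

section
variable {k : Type*} [Field k] {n : ℕ}

/-- The family with components `F0`, `F1`, `F2` in arities `0`, `1`, `2`, and zero otherwise. -/
noncomputable def fam (F0 : Fin (n + 1) → Mat k) (F1 : Fin (n + 1) → Fin (n + 1) → k[X] → Mat k)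
    (F2 : Fin (n + 1) → Fin (n + 1) → Fin (n + 1) → k[X] → k[X] → Mat k) : Family k n
  | 0, x, _ => F0 (x 0)
  | 1, x, a => F1 (x 0) (x 1) (a 0)
  | 2, x, a => F2 (x 0) (x 1) (x 2) (a 1) (a 0)
  | _, _, _ => 0

lemma eq_fam {φ : Family k n} (h : ∀ d, 2 < d → φ d = 0) :
    φ = fam (fun j => φ 0 ![j] ![]) (fun j l f => φ 1 ![j, l] ![f])
      (fun j m l g f => φ 2 ![j, m, l] ![f, g]) := by
  funext d x a
  match d with
  | 0 =>
    show φ 0 x a = φ 0 ![x 0] ![]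
    congr 1
    · funext m; fin_cases m; rfl
    · exact Subsingleton.elim _ _
  | 1 =>
    show φ 1 x a = φ 1 ![x 0, x 1] ![a 0]
    congr 1
    · funext m; fin_cases m <;> rfl
    · funext m; fin_cases m; rfl
  | 2 =>
    show φ 2 x a = φ 2 ![x 0, x 1, x 2] ![a 0, a 1]
    congr 1
    · funext m; fin_cases m <;> rfl
    · funext m; fin_cases m <;> rfl
  | d + 3 => rw [h (d + 3) (by omega)]; rfl

lemma fam_eq_zero (F0 : Fin (n + 1) → Mat k) (F1 : Fin (n + 1) → Fin (n + 1) → k[X] → Mat k)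
    (F2 : Fin (n + 1) → Fin (n + 1) → Fin (n + 1) → k[X] → k[X] → Mat k) {d : ℕ} (h : 2 < d) :
    fam F0 F1 F2 d = 0 := by
  obtain _ | _ | _ | d := d
  · omega
  · omega
  · omega
  · rfl

lemma negBraid_map_eq_zero (i : Fin (n + 1)) (h0 : 0 < (i : ℕ)) (h1 : (i : ℕ) < n) {d : ℕ}
    (h : 2 < d) : (negBraid k i h0 h1).map d = 0 := by
  obtain _ | _ | _ | d := d
  · omega
  · omega
  · omega
  · rfl

lemma incl_map_eq_zero {d : ℕ} (h : 1 < d) : (incl k n).map d = 0 := by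
  obtain _ | _ | d := d
  · omega
  · omega
  · rfl

variable (i : Fin (n + 1)) (h0 : 0 < (i : ℕ)) (h1 : (i : ℕ) < n)

/-- The differential of `Hom(T_j, β T_l)`, without sign. -/
noncomputable abbrev dcomp (j l : Fin (n + 1)) (f : Mat k) : Mat k :=
  comp (stalk k j) (braidObjs k i h0 h1 l) (braidObjs k i h0 h1 l) (braidObjs k i h0 h1 l).diff f

/-- The composition of `f : T_j → β T_m` with `β¹(g)`, `g : T_m → T_l`. -/
noncomputable abbrev lcomp (j m l : Fin (n + 1)) (g : k[X]) (f : Mat k) : Mat k :=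
  comp (stalk k j) (braidObjs k i h0 h1 m) (braidObjs k i h0 h1 l) (braid1 i m l g) f

/-- The composition of `g : T_m → β T_l` with `f : T_j → T_m`. -/
noncomputable abbrev rcomp (j m l : Fin (n + 1)) (g : Mat k) (f : k[X]) : Mat k :=
  comp (stalk k j) (stalk k m) (braidObjs k i h0 h1 l) g (entry 0 0 f)

/-- The composition of `f : T_j → β T_m` with `β²(h, g)`, `g : T_m → T_l`, `h : T_l → T_q`. -/
noncomputable abbrev bcomp (j m l q : Fin (n + 1)) (h g : k[X]) (f : Mat k) : Mat k :=
  comp (stalk k j) (braidObjs k i h0 h1 m) (braidObjs k i h0 h1 q) (braid2 i m l q h g) f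

variable (F0 : Fin (n + 1) → Mat k) (F1 : Fin (n + 1) → Fin (n + 1) → k[X] → Mat k)
    (F2 : Fin (n + 1) → Fin (n + 1) → Fin (n + 1) → k[X] → k[X] → Mat k)

lemma natDiff_one_fam_zero (x : Fin 1 → Fin (n + 1)) (a : Fin 0 → k[X]) :
    natDiff (incl k n) (negBraid k i h0 h1) 1 (fam 0 F1 F2) 0 x a = 0 := by
  simp [natDiff, mu1, mu2, Family.up, Family.low, Family.insertMul, fam, comp_zero, zero_comp]

lemma natDiff_one_fam_one (x : Fin 2 → Fin (n + 1)) (a : Fin 1 → k[X]) :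
    natDiff (incl k n) (negBraid k i h0 h1) 1 (fam 0 F1 F2) 1 x a =
      dcomp i h0 h1 (x 0) (x 1) (F1 (x 0) (x 1) (a 0)) := by
  simp [natDiff, mu1, mu2, Family.up, Family.low, Family.insertMul, fam, comp_zero, zero_comp,
    Fin.sum_univ_succ, incl, negBraid, inclMap, braidMap, stalk_diff]

lemma natDiff_one_fam_two (x : Fin 3 → Fin (n + 1)) (a : Fin 2 → k[X]) :
    natDiff (incl k n) (negBraid k i h0 h1) 1 (fam 0 F1 F2) 2 x a =
      lcomp i h0 h1 (x 0) (x 1) (x 2) (a 1) (F1 (x 0) (x 1) (a 0)) +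
      rcomp i h0 h1 (x 0) (x 1) (x 2) (F1 (x 1) (x 2) (a 1)) (a 0) -
      F1 (x 0) (x 2) (mul (x 0) (x 1) (x 2) (a 1) (a 0)) -
      dcomp i h0 h1 (x 0) (x 2) (F2 (x 0) (x 1) (x 2) (a 1) (a 0)) := by
  simp [natDiff, mu1, mu2, Family.up, Family.low, Family.insertMul, fam, comp_zero, zero_comp,
    Fin.sum_univ_succ, incl, negBraid, inclMap, braidMap, stalk_diff]
  abel

lemma natDiff_one_fam_three (x : Fin 4 → Fin (n + 1)) (a : Fin 3 → k[X]) :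
    natDiff (incl k n) (negBraid k i h0 h1) 1 (fam 0 F1 F2) 3 x a =
      bcomp i h0 h1 (x 0) (x 1) (x 2) (x 3) (a 2) (a 1) (F1 (x 0) (x 1) (a 0)) -
      lcomp i h0 h1 (x 0) (x 2) (x 3) (a 2) (F2 (x 0) (x 1) (x 2) (a 1) (a 0)) +
      rcomp i h0 h1 (x 0) (x 1) (x 3) (F2 (x 1) (x 2) (x 3) (a 2) (a 1)) (a 0) -
      F2 (x 0) (x 2) (x 3) (a 2) (mul (x 0) (x 1) (x 2) (a 1) (a 0)) +
      F2 (x 0) (x 1) (x 3) (mul (x 1) (x 2) (x 3) (a 2) (a 1)) (a 0) := by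
  simp [natDiff, mu1, mu2, Family.up, Family.low, Family.insertMul, fam, comp_zero,
    Fin.sum_univ_succ, incl, negBraid, inclMap, braidMap, stalk_diff]
  abel

/-- Neither `β` nor the family has components of arity above `2`, so the only term that could
survive is `β²` composed with `F2`, in arity `4`. -/
lemma natDiff_fam_of_three_lt (g : ℤ)
    (h : ∀ j m l q r a b c d, bcomp i h0 h1 j l q r a b (F2 j m l c d) = 0)
    {d : ℕ} (hd : 3 < d) (x : Fin (d + 1) → Fin (n + 1)) (a : Fin d → k[X]) :
    natDiff (incl k n) (negBraid k i h0 h1) g (fam F0 F1 F2) d x a = 0 := by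
  have hF : ∀ e, 2 < e → fam F0 F1 F2 e = 0 := fun e he => fam_eq_zero F0 F1 F2 he
  show mu1 _ _ _ _ + _ + _ - Family.insertMul _ _ _ _ _ = 0
  rw [Family.insertMul_eq_zero hF (by omega), hF _ (by omega)]
  simp only [mu2]
  rw [Finset.sum_eq_zero, Finset.sum_eq_zero]
  · simp [mu1, comp_zero, zero_comp]
  · intro p _
    have : comp ((incl k n).obj (x 0)) ((incl k n).obj (x p))
        ((negBraid k i h0 h1).obj (x (Fin.last d)))
        ((fam F0 F1 F2).up p x a) ((incl k n).map.low p x a) = 0 := by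
      by_cases hp : 1 < (p : ℕ)
      · rw [Family.low_eq_zero (fun e he => incl_map_eq_zero he) hp, comp_zero]
      · rw [Family.up_eq_zero hF (by omega), zero_comp]
    rw [this, smul_zero, smul_zero]
  · intro p _
    have : comp ((incl k n).obj (x 0)) ((negBraid k i h0 h1).obj (x p))
        ((negBraid k i h0 h1).obj (x (Fin.last d)))
        ((negBraid k i h0 h1).map.up p x a) ((fam F0 F1 F2).low p x a) = 0 := by
      by_cases hp : 2 < (p : ℕ)
      · rw [Family.low_eq_zero hF hp, comp_zero]
      by_cases hp' : 2 < d - (p : ℕ)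
      · rw [Family.up_eq_zero (fun e he => negBraid_map_eq_zero i h0 h1 he) hp', zero_comp]
      obtain rfl : d = 4 := by omega
      obtain rfl : p = 2 := by apply Fin.ext; show (p : ℕ) = 2; omega
      exact h _ _ _ _ _ _ _ _ _
    rw [this, smul_zero]

lemma natDiff_zero_fam_zero (x : Fin 1 → Fin (n + 1)) (a : Fin 0 → k[X]) :
    natDiff (incl k n) (negBraid k i h0 h1) 0 (fam F0 F1 0) 0 x a =
      dcomp i h0 h1 (x 0) (x 0) (F0 (x 0)) := by
  simp [natDiff, mu1, mu2, Family.up, Family.low, Family.insertMul, fam, comp_zero, zero_comp,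
    Fin.sum_univ_succ, incl, negBraid, inclMap, braidMap, stalk_diff]

lemma natDiff_zero_fam_one (x : Fin 2 → Fin (n + 1)) (a : Fin 1 → k[X]) :
    natDiff (incl k n) (negBraid k i h0 h1) 0 (fam F0 F1 0) 1 x a =
      lcomp i h0 h1 (x 0) (x 0) (x 1) (a 0) (F0 (x 0)) -
      rcomp i h0 h1 (x 0) (x 1) (x 1) (F0 (x 1)) (a 0) -
      dcomp i h0 h1 (x 0) (x 1) (F1 (x 0) (x 1) (a 0)) := by
  simp [natDiff, mu1, mu2, Family.up, Family.low, Family.insertMul, fam, comp_zero, zero_comp,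
    Fin.sum_univ_succ, incl, negBraid, inclMap, braidMap, stalk_diff]
  abel

lemma natDiff_zero_fam_two (x : Fin 3 → Fin (n + 1)) (a : Fin 2 → k[X]) :
    natDiff (incl k n) (negBraid k i h0 h1) 0 (fam F0 F1 0) 2 x a =
      bcomp i h0 h1 (x 0) (x 0) (x 1) (x 2) (a 1) (a 0) (F0 (x 0)) -
      lcomp i h0 h1 (x 0) (x 1) (x 2) (a 1) (F1 (x 0) (x 1) (a 0)) -
      rcomp i h0 h1 (x 0) (x 1) (x 2) (F1 (x 1) (x 2) (a 1)) (a 0) +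
      F1 (x 0) (x 2) (mul (x 0) (x 1) (x 2) (a 1) (a 0)) := by
  simp [natDiff, mu1, mu2, Family.up, Family.low, Family.insertMul, fam, comp_zero, zero_comp,
    Fin.sum_univ_succ, incl, negBraid, inclMap, braidMap, stalk_diff]
  abel

lemma natDiff_zero_fam_three (x : Fin 4 → Fin (n + 1)) (a : Fin 3 → k[X]) :
    natDiff (incl k n) (negBraid k i h0 h1) 0 (fam F0 F1 0) 3 x a =
      -bcomp i h0 h1 (x 0) (x 1) (x 2) (x 3) (a 2) (a 1) (F1 (x 0) (x 1) (a 0)) := by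
  simp [natDiff, mu1, mu2, Family.up, Family.low, Family.insertMul, fam, comp_zero, zero_comp,
    Fin.sum_univ_succ, incl, negBraid, inclMap, braidMap, stalk_diff]

end

/-! ### Compatibility of the compositions, and the Leibniz defect. -/

section
variable {k : Type*} [Field k] {n : ℕ}
variable (i : Fin (n + 1)) (h0 : 0 < (i : ℕ)) (h1 : (i : ℕ) < n)

lemma braid1_mem (j l : Fin (n + 1)) (f : k[X]) :
    braid1 i j l f ∈ TwHom 0 (braidObjs k i h0 h1 j) (braidObjs k i h0 h1 l) :=
  (negBraid k i h0 h1).degree 1 ![j, l] ![f]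

lemma braid2_mem (j m l : Fin (n + 1)) (g f : k[X]) :
    braid2 i j m l g f ∈ TwHom (-1) (braidObjs k i h0 h1 j) (braidObjs k i h0 h1 l) :=
  (negBraid k i h0 h1).degree 2 ![j, m, l] ![f, g]

lemma entry_stalk_mem (j l : Fin (n + 1)) (f : k[X]) :
    entry 0 0 f ∈ TwHom 0 (stalk k j) (stalk k l) :=
  entry_mem f Nat.one_pos Nat.one_pos rfl

variable {i h0 h1}

lemma lcomp_mem {p : ℤ} {j m : Fin (n + 1)} (l : Fin (n + 1)) (g : k[X]) {f : Mat k}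
    (hf : f ∈ TwHom p (stalk k j) (braidObjs k i h0 h1 m)) :
    lcomp i h0 h1 j m l g f ∈ TwHom p (stalk k j) (braidObjs k i h0 h1 l) := by
  simpa using comp_mem (braid1_mem i h0 h1 m l g) hf

lemma rcomp_mem {p : ℤ} (j : Fin (n + 1)) {m l : Fin (n + 1)} {g : Mat k} (f : k[X])
    (hg : g ∈ TwHom p (stalk k m) (braidObjs k i h0 h1 l)) :
    rcomp i h0 h1 j m l g f ∈ TwHom p (stalk k j) (braidObjs k i h0 h1 l) := by
  simpa using comp_mem hg (entry_stalk_mem j m f)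

lemma bcomp_mem {p : ℤ} {j m : Fin (n + 1)} (l q : Fin (n + 1)) (h g : k[X]) {f : Mat k}
    (hf : f ∈ TwHom p (stalk k j) (braidObjs k i h0 h1 m)) :
    bcomp i h0 h1 j m l q h g f ∈ TwHom (p - 1) (stalk k j) (braidObjs k i h0 h1 q) := by
  have := comp_mem (braid2_mem i h0 h1 m l q h g) hf
  rwa [neg_add_eq_sub] at this

lemma dcomp_mem {p : ℤ} {j l : Fin (n + 1)} {f : Mat k}
    (hf : f ∈ TwHom p (stalk k j) (braidObjs k i h0 h1 l)) :
    dcomp i h0 h1 j l f ∈ TwHom (p + 1) (stalk k j) (braidObjs k i h0 h1 l) := by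
  have := comp_mem (diff_mem _) hf
  rwa [add_comm] at this

lemma dcomp_eq_zero {j l : Fin (n + 1)} {f : Mat k}
    (hf : f ∈ TwHom 0 (stalk k j) (braidObjs k i h0 h1 l)) : dcomp i h0 h1 j l f = 0 :=
  hom_eq_zero i h0 h1 (by decide) (by decide) (dcomp_mem hf)

lemma bcomp_eq_zero {j m : Fin (n + 1)} (l q : Fin (n + 1)) (h g : k[X]) {f : Mat k}
    (hf : f ∈ TwHom (-1) (stalk k j) (braidObjs k i h0 h1 m)) :
    bcomp i h0 h1 j m l q h g f = 0 :=
  hom_eq_zero i h0 h1 (by decide) (by decide) (bcomp_mem l q h g hf)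

variable (i h0 h1)

lemma dcomp_lcomp (j m l : Fin (n + 1)) (g : k[X]) (f : Mat k) :
    dcomp i h0 h1 j l (lcomp i h0 h1 j m l g f) = lcomp i h0 h1 j m l g (dcomp i h0 h1 j m f) := by
  rw [dcomp, lcomp, ← comp_assoc, braid_rel1, comp_assoc]

lemma dcomp_rcomp (j m l : Fin (n + 1)) (g : Mat k) (f : k[X]) :
    dcomp i h0 h1 j l (rcomp i h0 h1 j m l g f) = rcomp i h0 h1 j m l (dcomp i h0 h1 m l g) f := by
  rw [dcomp, rcomp, ← comp_assoc]

lemma rcomp_lcomp (j m l q : Fin (n + 1)) (h : k[X]) (g : Mat k) (f : k[X]) :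
    rcomp i h0 h1 j m q (lcomp i h0 h1 m l q h g) f =
      lcomp i h0 h1 j l q h (rcomp i h0 h1 j m l g f) := by
  rw [rcomp, lcomp, comp_assoc]

lemma rcomp_rcomp (j m l q : Fin (n + 1)) (h : Mat k) (g f : k[X]) :
    rcomp i h0 h1 j m q (rcomp i h0 h1 m l q h g) f =
      rcomp i h0 h1 j l q h (mul j m l g f) := by
  rw [rcomp, rcomp, comp_assoc, comp_entry, if_pos ⟨rfl, Nat.one_pos⟩]
  rfl

/-- This is the `A_∞`-relation of `β` in arity `2`, composed with `f`: `β²` is a homotopy for the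
failure of `β¹` to be multiplicative. -/
lemma dcomp_bcomp (j m l q : Fin (n + 1)) (h g : k[X]) (f : Mat k) :
    dcomp i h0 h1 j q (bcomp i h0 h1 j m l q h g f) =
      lcomp i h0 h1 j l q h (lcomp i h0 h1 j m l g f) -
      lcomp i h0 h1 j m q (mul m l q h g) f - bcomp i h0 h1 j m l q h g (dcomp i h0 h1 j m f) := by
  have := congrArg (fun F => comp (stalk k j) (braidObjs k i h0 h1 m) (braidObjs k i h0 h1 q) F f) (braid_rel2 i h0 h1 m l q h g)
  simp only [add_comp, comp_assoc] at this
  simp only [lcomp, dcomp, bcomp, this]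
  abel

/-- The failure of `F` to be a derivation. -/
noncomputable def leibniz (F : Fin (n + 1) → Fin (n + 1) → k[X] → Mat k) (j m l : Fin (n + 1))
    (g f : k[X]) : Mat k :=
  lcomp i h0 h1 j m l g (F j m f) + rcomp i h0 h1 j m l (F m l g) f - F j l (mul j m l g f)

variable {F : Fin (n + 1) → Fin (n + 1) → k[X] → Mat k}

lemma leibniz_mem (hF : ∀ j l f, F j l f ∈ TwHom 0 (stalk k j) (braidObjs k i h0 h1 l))
    (j m l : Fin (n + 1)) (g f : k[X]) :
    leibniz i h0 h1 F j m l g f ∈ TwHom 0 (stalk k j) (braidObjs k i h0 h1 l) :=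
  Submodule.sub_mem _ (Submodule.add_mem _ (lcomp_mem l g (hF j m f)) (rcomp_mem j f (hF m l g)))
    (hF _ _ _)

/-- The left side has degree `-1`, where the differential is injective, so it is enough that its
differential vanishes. There the terms in `F` cancel by associativity and `dcomp_bcomp`. -/
lemma cocycle_of_dcomp_eq_leibniz
    (hF : ∀ j l f, F j l f ∈ TwHom 0 (stalk k j) (braidObjs k i h0 h1 l))
    {G : Fin (n + 1) → Fin (n + 1) → Fin (n + 1) → k[X] → k[X] → Mat k}
    (hG : ∀ j m l g f, G j m l g f ∈ TwHom (-1) (stalk k j) (braidObjs k i h0 h1 l))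
    (h : ∀ j m l g f, dcomp i h0 h1 j l (G j m l g f) = leibniz i h0 h1 F j m l g f)
    (j m l q : Fin (n + 1)) (c b a : k[X]) :
    bcomp i h0 h1 j m l q c b (F j m a) - lcomp i h0 h1 j l q c (G j m l b a) +
      rcomp i h0 h1 j m q (G m l q c b) a - G j l q c (mul j m l b a) +
      G j m q (mul m l q c b) a = 0 := by
  refine eq_zero_of_diff_comp i h0 h1 (j := j) (l := q) ?_ ?_
  · exact Submodule.add_mem _ (Submodule.sub_mem _ (Submodule.add_mem _ (Submodule.sub_mem _
      (bcomp_mem l q c b (hF j m a)) (lcomp_mem q c (hG j m l b a)))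
      (rcomp_mem j a (hG m l q c b))) (hG _ _ _ _ _)) (hG _ _ _ _ _)
  · have e1 := dcomp_bcomp i h0 h1 j m l q c b (F j m a)
    have e2 := dcomp_lcomp i h0 h1 j l q c (G j m l b a)
    have e3 := dcomp_rcomp i h0 h1 j m q (G m l q c b) a
    have e4 := h j l q c (mul j m l b a)
    have e5 := h j m q (mul m l q c b) a
    have e6 := rcomp_lcomp i h0 h1 j m l q c (F m l b) a
    have e7 := rcomp_rcomp i h0 h1 j m l q (F l q c) b a
    rw [dcomp_eq_zero (hF j m a)] at e1
    rw [h] at e2 e3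
    simp only [dcomp, lcomp, rcomp, bcomp, leibniz, comp_add, comp_sub, add_comp, sub_comp,
      comp_zero, mul_assoc'] at *
    rw [e1, e2, e3, e4, e5, e6, e7]
    abel

/-- This is the part of `μ¹ ∘ μ¹ = 0` in arity `2`: the arity `2` component of a coboundary lifts
the Leibniz defect of its arity `1` component. -/
lemma dcomp_coboundary_two {Z0 : Fin (n + 1) → Mat k}
    {Z1 : Fin (n + 1) → Fin (n + 1) → k[X] → Mat k}
    (hZ0 : ∀ j, Z0 j ∈ TwHom 0 (stalk k j) (braidObjs k i h0 h1 j))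
    (j m l : Fin (n + 1)) (g f : k[X]) :
    dcomp i h0 h1 j l (bcomp i h0 h1 j j m l g f (Z0 j) - lcomp i h0 h1 j m l g (Z1 j m f) -
      rcomp i h0 h1 j m l (Z1 m l g) f + Z1 j l (mul j m l g f)) =
    leibniz i h0 h1 (fun j l f => lcomp i h0 h1 j j l f (Z0 j) - rcomp i h0 h1 j l l (Z0 l) f -
      dcomp i h0 h1 j l (Z1 j l f)) j m l g f := by
  have e1 := dcomp_bcomp i h0 h1 j j m l g f (Z0 j)
  have e2 := dcomp_lcomp i h0 h1 j m l g (Z1 j m f)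
  have e3 := dcomp_rcomp i h0 h1 j m l (Z1 m l g) f
  have e6 := rcomp_lcomp i h0 h1 j m m l g (Z0 m) f
  have e7 := rcomp_rcomp i h0 h1 j m l l (Z0 l) g f
  rw [dcomp_eq_zero (hZ0 j)] at e1
  simp only [dcomp, lcomp, rcomp, bcomp, leibniz, comp_add, comp_sub, sub_comp,
    comp_zero] at *
  rw [e1, e2, e3, e6, e7]
  abel

lemma proj_leibniz (j m l : Fin (n + 1)) (g f : k[X]) :
    proj i j l (leibniz i h0 h1 F j m l g f) =
      (X ^ ((l : ℕ) - (m : ℕ)) * g) * proj i j m (F j m f) +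
      proj i m l (F m l g) * (X ^ ((m : ℕ) - (j : ℕ)) * f) - proj i j l (F j l (mul j m l g f)) := by
  rw [leibniz, map_sub, map_add, proj_braid1_comp, proj_entry_comp]

/-! ### The Euler derivation and its lift. -/

/-- The component `η¹` of the transformation of parameter `p`. -/
noncomputable def etaOne (p : k[X]) (j l : Fin (n + 1)) (f : k[X]) : Mat k :=
  -- On `f = X ^ α` the second factor is `𝔮(a_{lj} s^α) X ^ α`.
  if l ≠ i then entry 0 0 (p * (2 * X * derivative f + (gap j l : k[X]) * f))
  else if j < i then entry 1 0 (p * (2 * X * derivative f + (gap j l : k[X]) * f))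
  else if i < j then entry 2 0 (p * (2 * X * derivative f + (gap j l : k[X]) * f))
  -- For `j = l = i` the projection has to be `2 X p f'`, and `proj` multiplies each row by `X`; the
  -- two rows share this value equally.
  else entry 1 0 (p * derivative f) + entry 2 0 (p * derivative f)

lemma etaOne_mem (p : k[X]) (j l : Fin (n + 1)) (f : k[X]) :
    etaOne i p j l f ∈ TwHom 0 (stalk k j) (braidObjs k i h0 h1 l) := by
  unfold etaOne
  split_ifs with hl
  · rw [braidObjs_ne i h0 h1 hl]
    exact entry_stalk_mem _ _ _
  all_goals
    rw [not_not] at hl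
    subst hl
    rw [braidObjs_self]
  · exact entry_mem _ (by decide : 1 < 3) Nat.one_pos rfl
  · exact entry_mem _ (by decide : 2 < 3) Nat.one_pos rfl
  · exact Submodule.add_mem _ (entry_mem _ (by decide : 1 < 3) Nat.one_pos rfl)
      (entry_mem _ (by decide : 2 < 3) Nat.one_pos rfl)

lemma etaOne_add_right (p : k[X]) (j l : Fin (n + 1)) (f g : k[X]) :
    etaOne i p j l (f + g) = etaOne i p j l f + etaOne i p j l g := by
  simp only [etaOne, derivative_add, mul_add]
  split_ifs <;> simp only [entry_add] <;> abel

lemma etaOne_smul_right (p : k[X]) (j l : Fin (n + 1)) (c : k) (f : k[X]) :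
    etaOne i p j l (c • f) = c • etaOne i p j l f := by
  simp only [etaOne, derivative_smul, mul_smul_comm, ← smul_add]
  split_ifs <;> simp only [entry_smul, smul_add]

lemma etaOne_add_left (p q : k[X]) (j l : Fin (n + 1)) (f : k[X]) :
    etaOne i (p + q) j l f = etaOne i p j l f + etaOne i q j l f := by
  simp only [etaOne, add_mul]
  split_ifs <;> simp only [entry_add]
  abel

lemma etaOne_smul_left (c : k) (p : k[X]) (j l : Fin (n + 1)) (f : k[X]) :
    etaOne i (c • p) j l f = c • etaOne i p j l f := by
  simp only [etaOne, smul_mul_assoc]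
  split_ifs <;> simp only [entry_smul, smul_add]

lemma X_mul_derivative_X_pow_mul (e : ℕ) (f : k[X]) :
    X * derivative (X ^ e * f) = X ^ e * ((e : k[X]) * f + X * derivative f) := by
  obtain _ | e := e
  · simp
  · rw [derivative_mul, derivative_X_pow, Nat.add_sub_cancel, C_eq_natCast]
    ring

/-- The identity `|t| = 2 t⁺ - t` rewrites `𝔮` as twice the exponent in the embedding plus `j - l`,
a form without absolute values. -/
lemma gap_cast (l j : Fin (n + 1)) :
    (gap j l : k[X]) = 2 * (((l : ℕ) - (j : ℕ) : ℕ) : k[X]) + ((j : ℕ) : k[X]) - ((l : ℕ) : k[X]) := by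
  have : gap j l + (l : ℕ) = 2 * ((l : ℕ) - (j : ℕ)) + j := by unfold gap; omega
  rw [eq_sub_iff_add_eq]
  exact_mod_cast congrArg (Nat.cast (R := k[X])) this

include h0 in
lemma proj_etaOne (p : k[X]) (j l : Fin (n + 1)) (f : k[X]) :
    proj i j l (etaOne i p j l f) = p * (2 * (X * derivative (X ^ ((l : ℕ) - (j : ℕ)) * f)) +
      (((j : ℕ) : k[X]) - ((l : ℕ) : k[X])) * (X ^ ((l : ℕ) - (j : ℕ)) * f)) := by
  rw [X_mul_derivative_X_pow_mul]
  by_cases hl : l = i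
  · subst hl
    rw [proj_self]
    rcases lt_trichotomy j l with hj | rfl | hj
    · have e1 : (l : ℕ) - j = l - 1 - j + 1 := by omega
      simp only [etaOne, ne_eq, not_true_eq_false, if_false, if_pos hj, entry_apply, and_self,
        if_true, gap_cast]
      rw [if_neg (by decide)]
      rw [e1]
      push_cast
      ring
    · have e1 : (j : ℕ) - 1 - j = 0 := by omega
      have e2 : (j : ℕ) + 1 - j = 1 := by omega
      simp [etaOne, entry_apply, e1, e2]
      ring
    · have e1 : (l : ℕ) - j = 0 := by omega
      have e2 : (l : ℕ) + 1 - j = 0 := by omega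
      simp only [etaOne, ne_eq, not_true_eq_false, if_false, if_pos hj, if_neg hj.not_gt,
        entry_apply, and_self, if_true, gap_cast, e1, e2]
      rw [if_neg (by decide)]
      push_cast
      ring
  · rw [proj_ne i j hl, etaOne, if_pos hl, entry_apply, if_pos ⟨rfl, rfl⟩, gap_cast]
    ring

include h0 in
-- In `k[s]` the operator `2 X d/dX` is a derivation, and the weights add up along a composition:
-- `(j - m) + (m - l) = j - l`.
lemma proj_leibniz_etaOne (p : k[X]) (j m l : Fin (n + 1)) (g f : k[X]) :
    proj i j l (leibniz i h0 h1 (etaOne i p) j m l g f) = 0 := by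
  rw [proj_leibniz, proj_etaOne i h0, proj_etaOne i h0, proj_etaOne i h0, X_pow_mul_mul,
    derivative_mul (f := X ^ ((l : ℕ) - (m : ℕ)) * g)]
  ring

/-- The component `η²` of the transformation of parameter `p`. -/
noncomputable def etaTwo (p : k[X]) (j m l : Fin (n + 1)) (g f : k[X]) : Mat k :=
  retr i j l (leibniz i h0 h1 (etaOne i p) j m l g f)

lemma dcomp_etaTwo (p : k[X]) (j m l : Fin (n + 1)) (g f : k[X]) :
    dcomp i h0 h1 j l (etaTwo i h0 h1 p j m l g f) =
      leibniz i h0 h1 (etaOne i p) j m l g f :=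
  eq_diff_comp_retr i h0 h1 (leibniz_mem i h0 h1 (etaOne_mem i h0 h1 p) j m l g f)
    (proj_leibniz_etaOne i h0 h1 p j m l g f)

end

/-! ### Values on monomials: the explicit formulas. -/

section
variable {k : Type*} [Field k] {n : ℕ}

/-- `σ ↦ ∑_ℓ (1/2) σ_ℓ s^ℓ`. -/
noncomputable def halfPoly (k : Type*) [Field k] : (ℕ →₀ k) →ₗ[k] k[X] :=
  Finsupp.lsum k fun ℓ => (2⁻¹ : k) • monomial ℓ

lemma halfPoly_apply (σ : ℕ →₀ k) : halfPoly k σ = σ.sum fun ℓ c => C (2⁻¹ * c) * X ^ ℓ := by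
  rw [halfPoly, Finsupp.lsum_apply]
  congr 1
  funext ℓ c
  rw [LinearMap.smul_apply, smul_monomial, smul_eq_mul, C_mul_X_pow_eq_monomial]

lemma halfPoly_bijective (h2 : (2 : k) ≠ 0) : Function.Bijective (halfPoly k) := by
  constructor
  · rw [injective_iff_map_eq_zero]
    intro σ h
    ext ℓ
    have := congrArg (fun p => coeff p ℓ) h
    simp only [halfPoly_apply, Finsupp.sum, finsetSum_coeff, coeff_C_mul, coeff_X_pow] at this
    simpa [h2] using this
  · intro p
    induction p using Polynomial.induction_on' with
    | add p q hp hq =>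
      obtain ⟨σ, rfl⟩ := hp
      obtain ⟨τ, rfl⟩ := hq
      exact ⟨σ + τ, map_add _ _ _⟩
    | monomial ℓ c =>
      refine ⟨Finsupp.single ℓ (2 * c), ?_⟩
      rw [halfPoly_apply, Finsupp.sum_single_index (by simp), inv_mul_cancel_left₀ h2,
        C_mul_X_pow_eq_monomial]

lemma halfSum_eq (σ : ℕ →₀ k) (e : ℕ) : halfSum σ e = X ^ e * halfPoly k σ := by
  rw [halfPoly_apply, halfSum, Finsupp.mul_sum]
  congr 1
  funext ℓ c
  rw [pow_add]; ring

lemma halfSumPred_succ (σ : ℕ →₀ k) (e : ℕ) : halfSumPred σ (e + 1) = X ^ e * halfPoly k σ := by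
  rw [halfPoly_apply, halfSumPred, Finsupp.mul_sum]
  congr 1
  funext ℓ c
  rw [add_right_comm, Nat.add_sub_cancel, pow_add]; ring

/-- At `e = 0` the truncated exponents on both sides are wrong, but the scalar is zero. -/
lemma natCast_smul_halfSumPred (σ : ℕ →₀ k) (e : ℕ) :
    (e : k) • halfSumPred σ e = (e : k[X]) * X ^ (e - 1) * halfPoly k σ := by
  obtain _ | e := e
  · simp
  · rw [halfSumPred_succ, Nat.add_sub_cancel, smul_eq_C_mul, C_eq_natCast, mul_assoc]

lemma qdeg_add (j m l : Fin (n + 1)) (α β : ℕ) :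
    qdeg m j α + qdeg l m β = qdeg l j (β + α + overlap j m l) := by
  rw [overlap_eq]; unfold qdeg gap; omega

lemma qdeg_self (j : Fin (n + 1)) (α : ℕ) : qdeg j j α = 2 * α := by
  simp [qdeg, gap]

variable {i : Fin (n + 1)}

lemma euler_X_pow (l j : Fin (n + 1)) (α : ℕ) :
    2 * X * derivative (X ^ α : k[X]) + (gap j l : k[X]) * X ^ α = (qdeg l j α : k[X]) * X ^ α := by
  have := X_mul_derivative_X_pow_mul (k := k) α 1
  rw [derivative_one, mul_zero, add_zero, mul_one, mul_one] at this
  rw [mul_assoc, this, qdeg]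
  push_cast
  ring

lemma etaOne_X_pow_ne (p : k[X]) (j : Fin (n + 1)) {l : Fin (n + 1)} (hl : l ≠ i) (α : ℕ) :
    etaOne i p j l (X ^ α) = entry 0 0 (p * ((qdeg l j α : k[X]) * X ^ α)) := by
  rw [etaOne, if_pos hl, euler_X_pow]

lemma etaOne_X_pow_lt (p : k[X]) {j : Fin (n + 1)} (hj : j < i) (α : ℕ) :
    etaOne i p j i (X ^ α) = entry 1 0 (p * ((qdeg i j α : k[X]) * X ^ α)) := by
  rw [etaOne, if_neg (not_not.2 rfl), if_pos hj, euler_X_pow]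

lemma etaOne_X_pow_gt (p : k[X]) {j : Fin (n + 1)} (hj : i < j) (α : ℕ) :
    etaOne i p j i (X ^ α) = entry 2 0 (p * ((qdeg i j α : k[X]) * X ^ α)) := by
  rw [etaOne, if_neg (not_not.2 rfl), if_neg hj.not_gt, if_pos hj, euler_X_pow]

lemma etaOne_X_pow_self (p : k[X]) (α : ℕ) :
    etaOne i p i i (X ^ α) = entry 1 0 (p * ((α : k[X]) * X ^ (α - 1))) +
      entry 2 0 (p * ((α : k[X]) * X ^ (α - 1))) := by
  rw [etaOne, if_neg (not_not.2 rfl), if_neg (lt_irrefl _), if_neg (lt_irrefl _),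
    derivative_X_pow, C_eq_natCast]

lemma two_inv_mul_qdeg_self (h2 : (2 : k) ≠ 0) (j : Fin (n + 1)) (α : ℕ) :
    2⁻¹ * (qdeg j j α : k) = α := by
  rw [qdeg_self]; push_cast; field_simp

lemma etaOne_eq_eta1 (h2 : (2 : k) ≠ 0) (σ : ℕ →₀ k) (j l : Fin (n + 1)) (α : ℕ) :
    etaOne i (halfPoly k σ) j l (X ^ α) = eta1 i σ j l α := by
  have e (l j : Fin (n + 1)) : halfPoly k σ * ((qdeg l j α : k[X]) * X ^ α) =
      (qdeg l j α : k) • halfSum σ α := by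
    rw [halfSum_eq, smul_eq_C_mul, C_eq_natCast]; ring
  by_cases hl : l = i
  · subst hl
    rw [eta1, if_neg (not_not.2 rfl)]
    rcases lt_trichotomy j l with hj | rfl | hj
    · rw [etaOne_X_pow_lt _ hj, if_pos hj, e]
    · have e' : halfPoly k σ * ((α : k[X]) * X ^ (α - 1)) =
          (qdeg j j α : k) • (2⁻¹ : k) • halfSumPred σ α := by
        rw [smul_smul, mul_comm (qdeg j j α : k), two_inv_mul_qdeg_self h2,
          natCast_smul_halfSumPred, mul_comm]
      rw [etaOne_X_pow_self, if_neg (lt_irrefl _), if_neg (lt_irrefl _), e']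
    · rw [etaOne_X_pow_gt _ hj, if_pos hj, if_neg hj.not_gt, e]
  · rw [etaOne_X_pow_ne _ _ hl, eta1, if_pos hl, e]

lemma mul_entry_left (j m l : Fin (n + 1)) (p : k[X]) (q α β : ℕ) :
    mul j m l (X ^ β) (p * ((q : k[X]) * X ^ α)) =
      (q : k[X]) * X ^ (β + α + overlap j m l) * p := by
  rw [mul]; ring

lemma mul_entry_right (j m l : Fin (n + 1)) (p : k[X]) (q α β : ℕ) :
    mul j m l (p * ((q : k[X]) * X ^ β)) (X ^ α) =
      (q : k[X]) * X ^ (β + α + overlap j m l) * p := by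
  rw [mul]; ring

lemma mul_X_pow (j m l : Fin (n + 1)) (α β : ℕ) :
    mul j m l (X ^ β) (X ^ α : k[X]) = X ^ (β + α + overlap j m l) := by
  rw [mul]; ring

variable (h0 : 0 < (i : ℕ)) (h1 : (i : ℕ) < n)

lemma sgn_of_lt {i m : Fin (n + 1)} (h : m < i) : sgn i m = 1 :=
  Int.sign_eq_one_of_pos (by omega)

lemma sgn_of_gt {i m : Fin (n + 1)} (h : i < m) : sgn i m = -1 :=
  Int.sign_eq_neg_one_of_neg (by omega)

lemma sgn_self (i : Fin (n + 1)) : sgn i i = 0 := by simp [sgn]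

lemma natCast_smul_halfSumPred_of_pos (σ : ℕ →₀ k) (q : ℕ) {e e' : ℕ} (h : e = e' + 1) :
    (q : k) • halfSumPred σ e = (q : k[X]) * X ^ e' * halfPoly k σ := by
  rw [h, halfSumPred_succ, smul_eq_C_mul, C_eq_natCast, mul_assoc]

lemma natCast_smul_halfSumPred_add (σ : ℕ →₀ k) (β α : ℕ) :
    (β : k) • halfSumPred σ (β + α) = (β : k[X]) * X ^ (β - 1 + α) * halfPoly k σ := by
  obtain _ | β := β
  · simp
  · exact natCast_smul_halfSumPred_of_pos σ _ (by omega)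

/-- Only `l = i` matters, since `retr` vanishes otherwise. The nine positions of `j` and `m`
relative to `i` are then compared by reading off the row chosen by `retr`; with `j` and `m` strictly
on the same side of `i`, both sides vanish. -/
lemma etaTwo_eq_eta2 (h2 : (2 : k) ≠ 0) (σ : ℕ →₀ k) (j m l : Fin (n + 1)) (α β : ℕ) :
    etaTwo i h0 h1 (halfPoly k σ) j m l (X ^ β) (X ^ α) = eta2 i σ j m l β α := by
  by_cases hl : l = i
  swap
  · simp [etaTwo, retr, eta2, hl]
  subst hl
  simp only [etaTwo, retr, eta2, if_true, LinearMap.coe_mk, AddHom.coe_mk, leibniz, lcomp, rcomp,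
    mul_X_pow, coeffQ]
  -- Additivity of `𝔮` turns a sum of the degrees of the two factors into the degree of the product,
  -- the form used in `𝔔`.
  have hq : (qdeg l m β : k[X]) + qdeg m j α = qdeg l j (β + α + overlap j m l) := by
    rw [← qdeg_add, add_comm]; push_cast; ring
  congr 1
  rcases lt_trichotomy j l with hj | hj | hj <;> rcases lt_trichotomy m l with hm | hm | hm
  all_goals try subst hj
  all_goals try subst hm
  all_goals
    try have hj' := hj.ne
    try have hj'' := hj.ne'
    try have hj''' := hj.not_gt
    try have hm' := hm.ne
    try have hm'' := hm.ne'
    try have hm''' := hm.not_gt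
    simp [etaOne_X_pow_ne, etaOne_X_pow_lt, etaOne_X_pow_gt, etaOne_X_pow_self, braid1,
      comp_entry, add_comp, comp_add, braidObjs_ne, braidObjs_self, stalk_len, entry_apply,
      braidObj_len, stalk_obj, braidObj_obj1, braidObj_obj2, mul_entry_left, mul_entry_right,
      sgn_of_lt, sgn_of_gt, sgn_self, mul_assoc, two_inv_mul_qdeg_self h2, -mul_eq_mul_left_iff,
      *] at hq ⊢
  · have e1 : overlap j m ⟨m + 1, by omega⟩ = 0 := by rw [overlap_eq]; dsimp only; omega
    have e2 : overlap j m m = 0 := by rw [overlap_eq]; omega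
    rw [e1, e2, add_zero, add_zero, natCast_smul_halfSumPred_add]; ring
  -- For `j < i < m`, moving the target from `i` to `i + 1` lowers the overlap by one. This is the
  -- source of the shift by `-1` in the exponent of `η²`.
  · have e2 : β + α + overlap j m l = β + α + overlap j m ⟨l + 1, by omega⟩ + 1 := by
      simp only [overlap_eq]; omega
    rw [natCast_smul_halfSumPred_of_pos σ _ e2, ← hq]; ring
  · have := natCast_smul_halfSumPred σ (β + α + overlap j m j)
    push_cast at this
    rw [this]; ring
  · have e1 : overlap m m ⟨m + 1, by omega⟩ = 0 := by rw [overlap_eq]; dsimp only; omega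
    have e2 : overlap m m m = 0 := by rw [overlap_eq]; omega
    have e3 : overlap m ⟨m + 1, by omega⟩ ⟨m + 1, by omega⟩ = 0 := by
      rw [overlap_eq]; dsimp only; omega
    rw [e1, e2, e3]
    -- The exponents `α - 1` and `β - 1` are truncated, so zero exponents are treated apart; the
    -- terms cancel by the product rule.
    obtain _ | α := α
    · simp; ring
    obtain _ | β := β
    · simp; ring
    have e4 : β + 1 + (α + 1) + 0 - 1 = β + α + 1 := by omega
    rw [e4, Nat.add_sub_cancel, Nat.add_sub_cancel]
    push_cast
    ring
  · have e2 : β + α + overlap j m j = β + α + overlap j m ⟨j + 1, by omega⟩ + 1 := by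
      simp only [overlap_eq]; omega
    have e3 := natCast_smul_halfSumPred σ (β + α + overlap j m j)
    have e4 : (-(overlap j m j : k) + (-(α : k) + -(β : k))) =
      -((β + α + overlap j m j : ℕ) : k) := by push_cast; ring
    have e5 : (β + α + overlap j m j) - 1 = β + α + overlap j m ⟨j + 1, by omega⟩ := by omega
    rw [qdeg_self] at hq
    push_cast at hq
    rw [e4, neg_smul, e3, e5, ← add_mul, add_comm (qdeg m j α : k[X]), hq]
    push_cast
    ring
  · have e2 : β + α + overlap j m l = β + α + overlap j m ⟨l - 1, by omega⟩ + 1 := by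
      simp only [overlap_eq]; omega
    rw [natCast_smul_halfSumPred_of_pos σ _ e2, ← hq]; ring
  · have e1 : overlap j m ⟨m - 1, by omega⟩ = 0 := by rw [overlap_eq]; dsimp only; omega
    have e2 : overlap j m m = 0 := by rw [overlap_eq]; omega
    rw [e1, e2, add_zero, add_zero, natCast_smul_halfSumPred_add]; ring

end

/-! ### The transformations as linear functions of `p`, and their cocycle property. -/

section
variable {k : Type*} [Field k] {n : ℕ}

lemma multilinear_two_of_bilinear {B : k[X] → k[X] → Mat k} (φ : (Fin 2 → k[X]) → Mat k)
    (h : ∀ a, φ a = B (a 1) (a 0))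
    (hadd1 : ∀ g g' f, B (g + g') f = B g f + B g' f)
    (hadd2 : ∀ g f f', B g (f + f') = B g f + B g f')
    (hsmul1 : ∀ (c : k) g f, B (c • g) f = c • B g f)
    (hsmul2 : ∀ (c : k) g f, B g (c • f) = c • B g f) :
    ∃ f : MultilinearMap k (fun _ : Fin 2 => k[X]) (Mat k), ∀ a, φ a = f a := by
  refine ⟨MultilinearMap.mk (fun a => B (a 1) (a 0)) ?_ ?_, h⟩
  · intro _ m p f g
    fin_cases p <;> simp [hadd1, hadd2]
  · intro _ m p c f
    fin_cases p <;> simp [hsmul1, hsmul2]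

variable (i : Fin (n + 1)) (h0 : 0 < (i : ℕ)) (h1 : (i : ℕ) < n)

lemma braid1_add (j l : Fin (n + 1)) (f g : k[X]) :
    braid1 i j l (f + g) = braid1 i j l f + braid1 i j l g := by
  simp only [braid1]
  split_ifs <;> simp only [entry_add, mul_add] <;> abel

lemma braid1_smul (j l : Fin (n + 1)) (c : k) (f : k[X]) :
    braid1 i j l (c • f) = c • braid1 i j l f := by
  simp only [braid1]
  split_ifs <;> simp only [entry_smul, mul_smul_comm, smul_add]

section
variable {F : Fin (n + 1) → Fin (n + 1) → k[X] → Mat k}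

lemma leibniz_add_left (hF : ∀ j l f g, F j l (f + g) = F j l f + F j l g)
    (j m l : Fin (n + 1)) (g g' f : k[X]) :
    leibniz i h0 h1 F j m l (g + g') f =
      leibniz i h0 h1 F j m l g f + leibniz i h0 h1 F j m l g' f := by
  simp only [leibniz, lcomp, rcomp, braid1_add, add_comp, hF, add_mul']
  abel

lemma leibniz_add_right (hF : ∀ j l f g, F j l (f + g) = F j l f + F j l g)
    (j m l : Fin (n + 1)) (g f f' : k[X]) :
    leibniz i h0 h1 F j m l g (f + f') =
      leibniz i h0 h1 F j m l g f + leibniz i h0 h1 F j m l g f' := by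
  simp only [leibniz, lcomp, rcomp, comp_add, hF, mul_add', entry_add]
  abel

lemma leibniz_smul_left (hF : ∀ j l (c : k) f, F j l (c • f) = c • F j l f)
    (j m l : Fin (n + 1)) (c : k) (g f : k[X]) :
    leibniz i h0 h1 F j m l (c • g) f = c • leibniz i h0 h1 F j m l g f := by
  simp only [leibniz, lcomp, rcomp, braid1_smul, smul_comp, hF, smul_mul', smul_add, smul_sub]

lemma leibniz_smul_right (hF : ∀ j l (c : k) f, F j l (c • f) = c • F j l f)
    (j m l : Fin (n + 1)) (c : k) (g f : k[X]) :
    leibniz i h0 h1 F j m l g (c • f) = c • leibniz i h0 h1 F j m l g f := by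
  simp only [leibniz, lcomp, rcomp, comp_smul, hF, mul_smul', entry_smul, smul_add, smul_sub]

end

/-- The transformation of parameter `p`. -/
noncomputable def etaFam : k[X] →ₗ[k] Family k n where
  toFun p := fam 0 (etaOne i p) (etaTwo i h0 h1 p)
  map_add' p q := by
    funext d x a
    match d with
    | 0 => exact (add_zero _).symm
    | 1 => exact etaOne_add_left i p q _ _ _
    | 2 =>
      have : etaOne i (p + q) = etaOne i p + etaOne i q := by
        funext j l f; exact etaOne_add_left i p q j l f
      show etaTwo _ _ _ _ _ _ _ _ _ = etaTwo _ _ _ _ _ _ _ _ _ + etaTwo _ _ _ _ _ _ _ _ _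
      rw [etaTwo, etaTwo, etaTwo, ← map_add, this]
      congr 1
      simp only [leibniz, lcomp, rcomp, Pi.add_apply, comp_add, add_comp]
      abel
    | d + 3 => exact (add_zero _).symm
  map_smul' c p := by
    funext d x a
    rw [RingHom.id_apply]
    show _ = c • fam _ _ _ _ x a
    match d with
    | 0 => exact (smul_zero c).symm
    | 1 => exact etaOne_smul_left i c p _ _ _
    | 2 =>
      have : etaOne i (c • p) = c • etaOne i p := by
        funext j l f; exact etaOne_smul_left i c p j l f
      show etaTwo _ _ _ _ _ _ _ _ _ = c • etaTwo _ _ _ _ _ _ _ _ _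
      rw [etaTwo, etaTwo, ← map_smul, this]
      congr 1
      simp only [leibniz, lcomp, rcomp, Pi.smul_apply, comp_smul, smul_comp, smul_add, smul_sub]
    | d + 3 => exact (smul_zero c).symm

lemma etaTwo_mem (p : k[X]) (j m l : Fin (n + 1)) (g f : k[X]) :
    etaTwo i h0 h1 p j m l g f ∈ TwHom (-1) (stalk k j) (braidObjs k i h0 h1 l) :=
  retr_mem i h0 h1 j l _

lemma etaFam_mem_preNat (p : k[X]) :
    etaFam i h0 h1 p ∈ PreNat (incl k n) (negBraid k i h0 h1) 1 := by
  refine ⟨fun d x => ?_, fun d x a => ?_⟩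
  · match d with
    | 0 => exact ⟨0, fun _ => rfl⟩
    | 1 =>
      exact multilinear_one _ (fun _ => rfl) (etaOne_add_right i p _ _)
        (etaOne_smul_right i p _ _)
    | 2 =>
      refine multilinear_two_of_bilinear (B := etaTwo i h0 h1 p (x 0) (x 1) (x 2)) _
        (fun _ => rfl) ?_ ?_ ?_ ?_ <;> intros <;> simp only [etaTwo]
      · rw [leibniz_add_left i h0 h1 (etaOne_add_right i p), map_add]
      · rw [leibniz_add_right i h0 h1 (etaOne_add_right i p), map_add]
      · rw [leibniz_smul_left i h0 h1 (etaOne_smul_right i p), map_smul]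
      · rw [leibniz_smul_right i h0 h1 (etaOne_smul_right i p), map_smul]
    | d + 3 => exact ⟨0, fun _ => rfl⟩
  · match d with
    | 0 => exact Submodule.zero_mem _
    | 1 => exact etaOne_mem i h0 h1 p _ _ _
    | 2 => exact etaTwo_mem i h0 h1 p _ _ _ _ _
    | d + 3 => exact Submodule.zero_mem _

lemma etaFam_mem_natTrans (p : k[X]) :
    etaFam i h0 h1 p ∈ NatTrans (incl k n) (negBraid k i h0 h1) 1 := by
  refine ⟨etaFam_mem_preNat i h0 h1 p, LinearMap.mem_ker.2 ?_⟩
  funext d x a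
  show natDiff _ _ _ (fam _ _ _) d x a = 0
  match d with
  | 0 => exact natDiff_one_fam_zero i h0 h1 _ _ x a
  | 1 =>
    rw [natDiff_one_fam_one]
    exact dcomp_eq_zero (etaOne_mem i h0 h1 p _ _ _)
  | 2 =>
    rw [natDiff_one_fam_two, dcomp_etaTwo]
    exact sub_self _
  | 3 =>
    rw [natDiff_one_fam_three]
    exact cocycle_of_dcomp_eq_leibniz i h0 h1 (etaOne_mem i h0 h1 p) (etaTwo_mem i h0 h1 p)
      (dcomp_etaTwo i h0 h1 p) _ _ _ _ _ _ _
  | d + 4 =>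
    -- `β²` composed with `η²` has degree `-2`, where the morphism space is zero.
    exact natDiff_fam_of_three_lt i h0 h1 _ _ _ _
      (fun _ _ _ _ _ _ _ _ _ => bcomp_eq_zero _ _ _ _ (etaTwo_mem i h0 h1 p _ _ _ _ _))
      (by omega) x a

/-! ### Classification of derivations. -/

/-- Derivations with values in the cohomology bimodule of `β_i^-` are sums of a multiple of the
Euler derivation and an inner derivation. -/
lemma exists_eq_euler_add_inner (h2 : (2 : k) ≠ 0)
    {D : Fin (n + 1) → Fin (n + 1) → k[X] →ₗ[k] k[X]}
    (hD : ∀ j m l g f, D j l (mul j m l g f) = (X ^ ((l : ℕ) - (m : ℕ)) * g) * D j m f +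
      D m l g * (X ^ ((m : ℕ) - (j : ℕ)) * f))
    (hdvd : ∀ (j l : Fin (n + 1)) f, X ^ ((l : ℕ) - (j : ℕ)) ∣ D j l f) (hi : ∀ f, X ∣ D i i f) :
    ∃ (p : k[X]) (w : Fin (n + 1) → k[X]), w i = 0 ∧ ∀ j l f, D j l f =
      p * (2 * (X * derivative (X ^ ((l : ℕ) - (j : ℕ)) * f)) +
        (((j : ℕ) : k[X]) - ((l : ℕ) : k[X])) * (X ^ ((l : ℕ) - (j : ℕ)) * f)) +
      (X ^ ((l : ℕ) - (j : ℕ)) * f) * (w j - w l) := by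
  obtain ⟨c, hc⟩ := hi X
  -- The Euler derivation takes `s ∈ End(T_i)` to `2 s`, so this is the multiple that agrees with
  -- `D` there.
  set p : k[X] := C 2⁻¹ * c with hp
  have hp2 : p * 2 = c := by
    have : (C (2⁻¹ : k) : k[X]) * 2 = 1 := by
      rw [← C_ofNat, ← C_mul, inv_mul_cancel₀ h2, C_1]
    rw [hp, mul_right_comm, this, one_mul]
  set E : Fin (n + 1) → Fin (n + 1) → k[X] → k[X] := fun j l f =>
    p * (2 * (X * derivative (X ^ ((l : ℕ) - (j : ℕ)) * f)) +
        (((j : ℕ) : k[X]) - ((l : ℕ) : k[X])) * (X ^ ((l : ℕ) - (j : ℕ)) * f)) with hE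
  have hEdvd (j l : Fin (n + 1)) (f : k[X]) : X ^ ((l : ℕ) - (j : ℕ)) ∣ E j l f := by
    simp only [hE, X_mul_derivative_X_pow_mul]
    exact ⟨p * (2 * ((((l : ℕ) - (j : ℕ) : ℕ) : k[X]) * f + X * derivative f) +
      (((j : ℕ) : k[X]) - ((l : ℕ) : k[X])) * f), by ring⟩
  set D' : Fin (n + 1) → Fin (n + 1) → k[X] → k[X] := fun j l f => D j l f - E j l f with hD'
  have leib (j m l g f) : D' j l (mul j m l g f) = (X ^ ((l : ℕ) - (m : ℕ)) * g) * D' j m f +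
      D' m l g * (X ^ ((m : ℕ) - (j : ℕ)) * f) := by
    simp only [hD', hD, hE, X_pow_mul_mul]
    rw [derivative_mul (f := X ^ ((l : ℕ) - (m : ℕ)) * g)]
    ring
  have hov (j l : Fin (n + 1)) : overlap j j l = 0 := by rw [overlap_eq]; omega
  have hov' (j l : Fin (n + 1)) : overlap j l l = 0 := by rw [overlap_eq]; omega
  have d1 (j) : D' j j 1 = 0 := by
    have := leib j j j 1 1
    simp only [mul, hov, pow_zero, mul_one, one_mul, Nat.sub_self] at this
    exact left_eq_add.1 this
  have dXi : D' i i X = 0 := by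
    simp [hD', hE, hc, ← hp2]
    ring
  -- Centrality: `s a_{ji} = a_{ji} s` is differentiated in both ways, and `a_{ji}`, a power of `X`
  -- in the embedding, is cancelled.
  have dX (j) : D' j j X = 0 := by
    have e1 := leib i j j X 1
    have e2 := leib i i j 1 X
    simp only [mul, hov, hov', pow_zero, mul_one, one_mul, Nat.sub_self, dXi, mul_zero,
      zero_add] at e1 e2
    have h : D' j j X * X ^ ((j : ℕ) - (i : ℕ)) = 0 := by
      rw [e2] at e1
      linear_combination -e1
    exact (mul_eq_zero.1 h).resolve_right (pow_ne_zero _ X_ne_zero)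
  have dlin (j l f) : D' j l f = f * D' j l 1 := by
    induction f using Polynomial.induction_on' with
    | add f g hf hg =>
      rw [add_mul, ← hf, ← hg]
      simp only [hD', hE, map_add, mul_add]
      ring
    | monomial e c =>
      have key (e : ℕ) : D' j l (X ^ e) = X ^ e * D' j l 1 := by
        induction e with
        | zero => simp
        | succ e ih =>
          have := leib j l l X (X ^ e)
          simp only [mul, hov', pow_zero, one_mul, Nat.sub_self, dX, zero_mul, add_zero, ih] at this
          rw [pow_succ', this, mul_assoc]
      rw [← C_mul_X_pow_eq_monomial, mul_assoc, ← key]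
      simp only [hD', hE, ← smul_eq_C_mul, map_smul, mul_smul_comm, smul_sub, ← smul_add]
  -- The potential at `T_j` is the value on `a_{ji}` divided by `a_{ji}`; based at `T_i`, it
  -- vanishes there. The Leibniz rule for `a_{lj} a_{ji}` then gives the value on `a_{lj}`.
  have hv (j : Fin (n + 1)) : X ^ ((j : ℕ) - (i : ℕ)) ∣ D' i j 1 := dvd_sub (hdvd i j 1) (hEdvd i j 1)
  choose v hv using hv
  refine ⟨p, fun j => -v j, ?_, fun j l f => ?_⟩
  · have := hv i
    rw [d1, Nat.sub_self, pow_zero, one_mul] at this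
    exact neg_eq_zero.2 this.symm
  · have h := leib i j l 1 1
    rw [dlin i l, hv, hv] at h
    have e := X_pow_mul_mul (k := k) i j l 1 1
    have e' : D' j l 1 = X ^ ((l : ℕ) - (j : ℕ)) * (v l - v j) := by
      apply mul_right_cancel₀ (pow_ne_zero ((j : ℕ) - (i : ℕ)) (X_ne_zero (R := k)))
      linear_combination -h + v l * e
    have e'' := dlin j l f
    rw [e'] at e''
    linear_combination e''

end

/-! ### Cocycles modulo coboundaries. -/

section
variable {k : Type*} [Field k] {n : ℕ}
variable (i : Fin (n + 1)) (h0 : 0 < (i : ℕ)) (h1 : (i : ℕ) < n)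

lemma preNat_mem {g : ℤ} {η : Family k n} (hη : η ∈ PreNat (incl k n) (negBraid k i h0 h1) g)
    (d : ℕ) (x : Fin (d + 1) → Fin (n + 1)) (a : Fin d → k[X]) :
    η d x a ∈ TwHom (g - d) (stalk k (x 0)) (braidObjs k i h0 h1 (x (Fin.last d))) :=
  hη.2 d x a

lemma preNat_eq_zero {g : ℤ} {η : Family k n}
    (hη : η ∈ PreNat (incl k n) (negBraid k i h0 h1) g) {d : ℕ} (h : g - d ≠ 0)
    (h' : g - d ≠ -1) : η d = 0 := by
  funext x a
  exact hom_eq_zero i h0 h1 h h' (preNat_mem i h0 h1 hη d x a)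

/-- The components of a natural transformation of degree `1`. -/
lemma exists_eq_fam_of_mem_natTrans {θ : Family k n}
    (hθ : θ ∈ NatTrans (incl k n) (negBraid k i h0 h1) 1) :
    ∃ (T1 : Fin (n + 1) → Fin (n + 1) → k[X] →ₗ[k] Mat k)
      (T2 : Fin (n + 1) → Fin (n + 1) → Fin (n + 1) → k[X] → k[X] → Mat k),
      θ = fam 0 (fun j l f => T1 j l f) T2 ∧
      (∀ j l f, T1 j l f ∈ TwHom 0 (stalk k j) (braidObjs k i h0 h1 l)) ∧
      (∀ j m l g f, T2 j m l g f ∈ TwHom (-1) (stalk k j) (braidObjs k i h0 h1 l)) ∧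
      ∀ j m l g f, dcomp i h0 h1 j l (T2 j m l g f) =
        leibniz i h0 h1 (fun j l f => T1 j l f) j m l g f := by
  obtain ⟨hθ, hθ'⟩ := hθ
  choose M hM using fun j l : Fin (n + 1) => hθ.1 1 ![j, l]
  have h3 : ∀ d, 2 < d → θ d = 0 := fun d hd =>
    preNat_eq_zero i h0 h1 hθ (by omega) (by omega)
  -- The component of arity `0` has degree `1`, where the morphism space is zero.
  have hz : (fun j => θ 0 ![j] ![]) = 0 := by
    funext j
    rw [preNat_eq_zero i h0 h1 hθ (d := 0) (by decide) (by decide)]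
    rfl
  have hT (j l : Fin (n + 1)) (f : k[X]) : θ 1 ![j, l] ![f] =
      (MultilinearMap.ofSubsingleton k k[X] (Mat k) (0 : Fin 1)).symm (M j l) f := by
    rw [hM]
    exact congrArg (M j l) (funext fun m => by fin_cases m; rfl)
  have e : θ = _ := eq_fam h3
  simp only [hT] at e
  rw [hz] at e
  refine ⟨fun j l => (MultilinearMap.ofSubsingleton k k[X] (Mat k) (0 : Fin 1)).symm (M j l),
    _, e, fun j l f => ?_, fun j m l g f => ?_, fun j m l g f => ?_⟩
  · rw [← hT]
    exact preNat_mem i h0 h1 hθ 1 ![j, l] ![f]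
  · exact preNat_mem i h0 h1 hθ 2 ![j, m, l] ![f, g]
  · have := congrArg (fun φ : Family k n => φ 2 ![j, m, l] ![f, g]) (LinearMap.mem_ker.1 hθ')
    rw [e] at this
    simp only [natDiff_one_fam_two] at this
    exact (sub_eq_zero.1 this).symm

lemma pow_dvd_proj (j l : Fin (n + 1)) (f : Mat k) :
    X ^ ((l : ℕ) - (j : ℕ)) ∣ proj i j l f := by
  by_cases hl : l = i
  · subst hl
    rw [proj_self, ← mul_assoc, ← pow_succ']
    exact dvd_add (dvd_mul_of_dvd_left (pow_dvd_pow _ (by omega)) _)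
      (dvd_mul_of_dvd_left (pow_dvd_pow _ (by omega)) _)
  · rw [proj_ne i j hl]
    exact dvd_mul_right _ _

/-- At `(i, i)` the image lies in `s k[s]`, although the weight `(i - i)⁺` imposes nothing. This is
what makes `D(s) / 2s` a polynomial in the classification. -/
lemma X_dvd_proj_self (f : Mat k) : X ∣ proj i i i f := by
  rw [proj_self]
  have : (i : ℕ) + 1 - i = 1 := by omega
  rw [this, pow_one]
  exact dvd_add (dvd_mul_right _ _) (dvd_mul_right _ _)

lemma leibniz_sub (F G : Fin (n + 1) → Fin (n + 1) → k[X] → Mat k) (j m l : Fin (n + 1))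
    (g f : k[X]) : leibniz i h0 h1 (F - G) j m l g f =
      leibniz i h0 h1 F j m l g f - leibniz i h0 h1 G j m l g f := by
  simp only [leibniz, lcomp, rcomp, Pi.sub_apply, comp_sub, sub_comp]
  abel

/-- The inner derivation of the elements `Z0 j` of `Hom(T_j, β T_j)`. -/
noncomputable def innerDer (Z0 : Fin (n + 1) → Mat k) (j l : Fin (n + 1)) (f : k[X]) : Mat k :=
  lcomp i h0 h1 j j l f (Z0 j) - rcomp i h0 h1 j l l (Z0 l) f

lemma innerDer_add (Z0 : Fin (n + 1) → Mat k) (j l : Fin (n + 1)) (f g : k[X]) :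
    innerDer i h0 h1 Z0 j l (f + g) = innerDer i h0 h1 Z0 j l f + innerDer i h0 h1 Z0 j l g := by
  simp only [innerDer, lcomp, rcomp, braid1_add, entry_add, add_comp, comp_add]
  abel

lemma innerDer_smul (Z0 : Fin (n + 1) → Mat k) (j l : Fin (n + 1)) (c : k) (f : k[X]) :
    innerDer i h0 h1 Z0 j l (c • f) = c • innerDer i h0 h1 Z0 j l f := by
  simp only [innerDer, lcomp, rcomp, braid1_smul, entry_smul, smul_comp, comp_smul, smul_sub]

lemma innerDer_mem {Z0 : Fin (n + 1) → Mat k}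
    (hZ0 : ∀ j, Z0 j ∈ TwHom 0 (stalk k j) (braidObjs k i h0 h1 j)) (j l : Fin (n + 1))
    (f : k[X]) : innerDer i h0 h1 Z0 j l f ∈ TwHom 0 (stalk k j) (braidObjs k i h0 h1 l) :=
  Submodule.sub_mem _ (lcomp_mem l f (hZ0 j)) (rcomp_mem j f (hZ0 l))

lemma proj_innerDer (Z0 : Fin (n + 1) → Mat k) (j l : Fin (n + 1)) (f : k[X]) :
    proj i j l (innerDer i h0 h1 Z0 j l f) =
      X ^ ((l : ℕ) - (j : ℕ)) * f * (proj i j j (Z0 j) - proj i l l (Z0 l)) := by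
  rw [innerDer, map_sub, proj_braid1_comp, proj_entry_comp]
  ring

/-- Both sides have degree `-1` and lift the same Leibniz defect, so they agree by injectivity of
the differential. A coboundary therefore needs to be matched in arity `1` only. -/
lemma eq_coboundary_two {Z0 : Fin (n + 1) → Mat k}
    {Z1 A1 : Fin (n + 1) → Fin (n + 1) → k[X] → Mat k}
    {A2 : Fin (n + 1) → Fin (n + 1) → Fin (n + 1) → k[X] → k[X] → Mat k}
    (hZ0 : ∀ j, Z0 j ∈ TwHom 0 (stalk k j) (braidObjs k i h0 h1 j))
    (hZ1 : ∀ j l f, Z1 j l f ∈ TwHom (-1) (stalk k j) (braidObjs k i h0 h1 l))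
    (hA2 : ∀ j m l g f, A2 j m l g f ∈ TwHom (-1) (stalk k j) (braidObjs k i h0 h1 l))
    (hA2d : ∀ j m l g f, dcomp i h0 h1 j l (A2 j m l g f) = leibniz i h0 h1 A1 j m l g f)
    (hA1 : ∀ j l f, A1 j l f = innerDer i h0 h1 Z0 j l f - dcomp i h0 h1 j l (Z1 j l f))
    (j m l : Fin (n + 1)) (g f : k[X]) :
    A2 j m l g f = bcomp i h0 h1 j j m l g f (Z0 j) - lcomp i h0 h1 j m l g (Z1 j m f) -
      rcomp i h0 h1 j m l (Z1 m l g) f + Z1 j l (mul j m l g f) := by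
  rw [← sub_eq_zero]
  refine eq_zero_of_diff_comp i h0 h1 (j := j) (l := l) ?_ ?_
  · exact Submodule.sub_mem _ (hA2 _ _ _ _ _) (Submodule.add_mem _ (Submodule.sub_mem _
      (Submodule.sub_mem _ (bcomp_mem _ _ _ _ (hZ0 _)) (lcomp_mem _ _ (hZ1 _ _ _)))
      (rcomp_mem _ _ (hZ1 _ _ _))) (hZ1 _ _ _))
  · have e : A1 = fun j l f => lcomp i h0 h1 j j l f (Z0 j) - rcomp i h0 h1 j l l (Z0 l) f -
        dcomp i h0 h1 j l (Z1 j l f) := by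
      funext j l f
      exact hA1 j l f
    rw [comp_sub, sub_eq_zero]
    refine (hA2d j m l g f).trans ?_
    rw [e]
    exact (dcomp_coboundary_two i h0 h1 hZ0 j m l g f).symm

/-- The component of arity `1` of a transformation of degree `0` with component `Z0` of arity `0`
whose differential has `etaOne p - F` in arity `1`, provided that `etaOne p - F` agrees with the
inner derivation of `Z0` in cohomology. -/
noncomputable def primitive (Z0 : Fin (n + 1) → Mat k) (p : k[X]) (j l : Fin (n + 1))
    (F : k[X] →ₗ[k] Mat k) : k[X] →ₗ[k] Mat k :=
  (retr i j l).comp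
    ({ toFun := innerDer i h0 h1 Z0 j l
       map_add' := innerDer_add i h0 h1 Z0 j l
       map_smul' := innerDer_smul i h0 h1 Z0 j l } -
      ({ toFun := etaOne i p j l
         map_add' := etaOne_add_right i p j l
         map_smul' := etaOne_smul_right i p j l } - F))

lemma primitive_apply (Z0 : Fin (n + 1) → Mat k) (p : k[X]) (j l : Fin (n + 1))
    (F : k[X] →ₗ[k] Mat k) (f : k[X]) : primitive i h0 h1 Z0 p j l F f =
      retr i j l (innerDer i h0 h1 Z0 j l f - (etaOne i p j l f - F f)) := rfl

lemma exists_coboundary (h2 : (2 : k) ≠ 0) {θ : Family k n}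
    (hθ : θ ∈ NatTrans (incl k n) (negBraid k i h0 h1) 1) :
    ∃ p : k[X], ∃ ζ ∈ PreNat (incl k n) (negBraid k i h0 h1) 0,
      etaFam i h0 h1 p - θ = natDiff (incl k n) (negBraid k i h0 h1) 0 ζ := by
  obtain ⟨T1, T2, rfl, hT1, hT2, hd⟩ := exists_eq_fam_of_mem_natTrans i h0 h1 hθ
  obtain ⟨p, w, hw, hD⟩ := exists_eq_euler_add_inner i h2
    (D := fun j l => (proj i j l).comp (T1 j l))
    (fun j m l g f => by
      have := proj_leibniz (F := fun j l f => T1 j l f) i h0 h1 j m l g f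
      -- The Leibniz defect of `T1` is the differential of `T2`, so it disappears under `proj` and
      -- an honest derivation remains.
      rw [← hd, proj_diff_comp] at this
      exact (sub_eq_zero.1 this.symm).symm)
    (fun j l f => pow_dvd_proj i j l _) (fun f => X_dvd_proj_self i _)
  -- The sign comes from `etaOne p - T1`, whose projection is minus the inner part. Component `0` of
  -- `β T_i` has degree `-1`, so `Z0 i` has degree `0` only thanks to `w i = 0`.
  set Z0 : Fin (n + 1) → Mat k := fun j => -entry 0 0 (w j) with hZ0
  have hZ0m (j) : Z0 j ∈ TwHom 0 (stalk k j) (braidObjs k i h0 h1 j) := by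
    refine Submodule.neg_mem _ ?_
    by_cases hj : j = i
    · rw [hj, hw, entry_zero]
      exact Submodule.zero_mem _
    · rw [braidObjs_ne i h0 h1 hj]
      exact entry_stalk_mem _ _ _
  have hZ0p (j) : proj i j j (Z0 j) = -w j := by
    rw [hZ0, map_neg]
    by_cases hj : j = i
    · rw [hj, hw, entry_zero, map_zero]
    · rw [proj_ne i j hj, Nat.sub_self, pow_zero, one_mul, entry_apply, if_pos ⟨rfl, rfl⟩]
  set Z1 : Fin (n + 1) → Fin (n + 1) → k[X] →ₗ[k] Mat k :=
    fun j l => primitive i h0 h1 Z0 p j l (T1 j l) with hZ1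
  have hZ1m (j l f) : Z1 j l f ∈ TwHom (-1) (stalk k j) (braidObjs k i h0 h1 l) :=
    retr_mem i h0 h1 j l _
  have hZ1d (j l f) : etaOne i p j l f - T1 j l f = innerDer i h0 h1 Z0 j l f - dcomp i h0 h1 j l (Z1 j l f) := by
    have hm : innerDer i h0 h1 Z0 j l f - (etaOne i p j l f - T1 j l f) ∈
        TwHom 0 (stalk k j) (braidObjs k i h0 h1 l) :=
      Submodule.sub_mem _ (innerDer_mem i h0 h1 hZ0m j l f)
        (Submodule.sub_mem _ (etaOne_mem i h0 h1 p j l f) (hT1 j l f))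
    have := eq_diff_comp_retr i h0 h1 hm (by
      have hD' := hD j l f
      rw [LinearMap.comp_apply] at hD'
      rw [map_sub, map_sub, proj_innerDer, hZ0p, hZ0p, hD', proj_etaOne i h0]
      ring)
    simp only [hZ1, dcomp, primitive_apply]
    rw [this]
    abel
  have hA2m (j m l g f) : etaTwo i h0 h1 p j m l g f - T2 j m l g f ∈
      TwHom (-1) (stalk k j) (braidObjs k i h0 h1 l) :=
    Submodule.sub_mem _ (etaTwo_mem i h0 h1 p j m l g f) (hT2 j m l g f)
  have hA2d (j m l g f) : dcomp i h0 h1 j l (etaTwo i h0 h1 p j m l g f - T2 j m l g f) =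
      leibniz i h0 h1 (fun j l f => etaOne i p j l f - T1 j l f) j m l g f := by
    rw [dcomp, comp_sub]
    exact (congrArg₂ (· - ·) (dcomp_etaTwo i h0 h1 p _ _ _ _ _) (hd _ _ _ _ _)).trans
      (leibniz_sub i h0 h1 _ _ _ _ _ _ _).symm
  refine ⟨p, fam Z0 (fun j l f => Z1 j l f) 0, ⟨fun d x => ?_, fun d x a => ?_⟩, ?_⟩
  · match d with
    | 0 => exact ⟨MultilinearMap.constOfIsEmpty k _ (Z0 (x 0)), fun _ => rfl⟩
    | 1 =>
      refine multilinear_one (F := Z1 (x 0) (x 1)) _ (fun _ => rfl) ?_ ?_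
      · exact (Z1 (x 0) (x 1)).map_add
      · exact (Z1 (x 0) (x 1)).map_smul
    | 2 => exact ⟨0, fun _ => rfl⟩
    | d + 3 => exact ⟨0, fun _ => rfl⟩
  · match d with
    | 0 => exact hZ0m _
    | 1 => exact hZ1m _ _ _
    | 2 => exact Submodule.zero_mem _
    | d + 3 => exact Submodule.zero_mem _
  · funext d x a
    show fam _ _ _ _ x a - fam _ _ _ _ x a = _
    match d with
    | 0 =>
      rw [natDiff_zero_fam_zero, dcomp_eq_zero (hZ0m _)]
      exact sub_self _
    | 1 =>
      rw [natDiff_zero_fam_one]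
      exact hZ1d _ _ _
    | 2 =>
      rw [natDiff_zero_fam_two]
      exact eq_coboundary_two i h0 h1 hZ0m hZ1m hA2m hA2d hZ1d _ _ _ _ _
    | 3 =>
      rw [natDiff_zero_fam_three, bcomp_eq_zero _ _ _ _ (hZ1m _ _ _), neg_zero]
      exact sub_self _
    | d + 4 =>
      rw [natDiff_fam_of_three_lt i h0 h1 Z0 (fun j l f => Z1 j l f) 0 _ (fun _ _ _ _ _ _ _ _ _ => comp_zero _ _ _ _)
        (by omega)]
      exact sub_self _

/-- Evaluation on the endomorphism `s` of `T_0`, followed by `proj`, detects `p`: the coboundary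
gives a commutator in `k[s]` and a boundary, both zero, while `etaOne` gives `2 p s`. -/
lemma eq_zero_of_etaFam_eq_natDiff {p : k[X]} {ζ : Family k n}
    (hζ : ζ ∈ PreNat (incl k n) (negBraid k i h0 h1) 0)
    (h2 : (2 : k) ≠ 0) (h : etaFam i h0 h1 p = natDiff (incl k n) (negBraid k i h0 h1) 0 ζ) :
    p = 0 := by
  have h3 : ∀ d, 2 < d → ζ d = 0 := fun d hd =>
    preNat_eq_zero i h0 h1 hζ (by omega) (by omega)
  have e : ζ = _ := eq_fam h3
  have hz : (fun j m l g f => ζ 2 ![j, m, l] ![f, g]) = 0 := by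
    funext j m l g f
    rw [preNat_eq_zero i h0 h1 hζ (d := 2) (by decide) (by decide)]
    rfl
  rw [hz] at e
  have := congrArg (fun φ : Family k n => proj i 0 0 (φ 1 (fun _ => 0) (fun _ => X))) h
  rw [e] at this
  simp only [natDiff_zero_fam_one, map_sub] at this
  rw [proj_diff_comp, proj_braid1_comp, proj_entry_comp] at this
  have h' : proj i 0 0 (etaOne i p 0 0 X) = 0 := by
    refine this.trans ?_
    simp
    ring
  rw [proj_etaOne i h0] at h'
  simp at h'
  rcases h' with h' | h'
  · exact h'
  · exact absurd (C_eq_zero.1 h') h2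

end

end KLRW

/-! ### The theorem. -/

theorem mainTheorem8 (k : Type*) [Field k] (h2 : (2 : k) ≠ 0) (n : ℕ) (i : Fin (n + 1))
    (h0 : 0 < (i : ℕ)) (h1 : (i : ℕ) < n) :
    ∃ η : (ℕ →₀ k) →ₗ[k] KLRW.NatTrans (KLRW.incl k n) (KLRW.negBraid k i h0 h1) 1,
      (∀ σ : ℕ →₀ k,
        (∀ x a, (η σ : KLRW.Family k n) 0 x a = 0) ∧
        (∀ (j l : Fin (n + 1)) (α : ℕ),
          (η σ : KLRW.Family k n) 1 ![j, l] ![X ^ α] = KLRW.eta1 i σ j l α) ∧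
        (∀ (j m l : Fin (n + 1)) (α β : ℕ),
          (η σ : KLRW.Family k n) 2 ![j, m, l] ![X ^ α, X ^ β] = KLRW.eta2 i σ j m l β α) ∧
        (∀ d, 3 ≤ d → ∀ x a, (η σ : KLRW.Family k n) d x a = 0)) ∧
      Function.Bijective fun σ =>
        (KLRW.coboundaries (KLRW.incl k n) (KLRW.negBraid k i h0 h1) 1).mkQ (η σ) := by
  have hb := KLRW.halfPoly_bijective h2
  refine ⟨LinearMap.codRestrict _ ((KLRW.etaFam i h0 h1).comp (KLRW.halfPoly k))
    fun σ => KLRW.etaFam_mem_natTrans i h0 h1 _, fun σ => ⟨fun x a => rfl, fun j l α =>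
      KLRW.etaOne_eq_eta1 h2 σ j l α, fun j m l α β => KLRW.etaTwo_eq_eta2 h0 h1 h2 σ j m l α β,
      fun d hd x a => congrFun (congrFun (KLRW.fam_eq_zero _ _ _ hd) x) a⟩, ?_, ?_⟩
  · refine (injective_iff_map_eq_zero ((KLRW.coboundaries _ _ 1).mkQ.comp
      (LinearMap.codRestrict _ ((KLRW.etaFam i h0 h1).comp (KLRW.halfPoly k)) _))).2 ?_
    intro σ h
    rw [LinearMap.comp_apply, Submodule.mkQ_apply, Submodule.Quotient.mk_eq_zero] at h
    obtain ⟨ζ, hζ, h⟩ := h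
    exact (map_eq_zero_iff _ hb.1).1
      (KLRW.eq_zero_of_etaFam_eq_natDiff i h0 h1 hζ h2 h.symm)
  · intro q
    obtain ⟨θ, rfl⟩ := Submodule.mkQ_surjective _ q
    obtain ⟨p, ζ, hζ, h⟩ := KLRW.exists_coboundary i h0 h1 h2 θ.2
    obtain ⟨σ, rfl⟩ := hb.2 p
    exact ⟨σ, (Submodule.Quotient.eq _).2 ⟨ζ, hζ, h.symm⟩⟩
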